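/- Let $G$ be a Matsubara graph, i.e. a finite connected multigraph without loops (parallel lines are allowed) in which every vertex is an endpoint of at least two lines. Let $V$ be its set of vertices, and number its lines $1,\dots,I$; fix an orientation of each line. Put $s^v_i=+1$, $-1$ or $0$ according as line $i$ is oriented into $v$, is oriented away from $v$, or is not incident on $v$. Let $N_v\in\mathbb Z$ $(v\in V)$ satisfy $\sum_v N_v=0$, and for $q=(q_1,\dots,q_I)$ with all $q_i>0$ put $$S_G(q)=\sum_{n\in\mathbb Z^I}\ \prod_{v\in V}\delta_{T_v(n),N_v}\ \prod_{i=1}^I\frac1{n_i^2+q_i^2},\qquad T_v(n)=\sum_{i=1}^I s^v_i n_i .$$ Call a set $F$ of lines independent if for every $y\in\mathbb R^F$ there is exactly one $x=x(y)\in\mathbb R^I$ with $T_v(x)=N_v$ for all $v\in V$ and $x_l=y_l$ for all $l\in F$. For such an $F$ the Matsubara integral is $$I_G(q)=\int_{\mathbb R^F}\ \prod_{i=1}^I\frac1{x_i(y)^2+q_i^2}\,dy .$$ Independent sets exist, the sum and the integral converge absolutely for all $q$ with $q_i>0$, and on $\{q: q_i>0 \text{ for all } i\}$ the function $I_G$ is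 a rational function of $q$ with real coefficients whose denominator has no zero there and which does not depend on the choice of $F$. Let $\hat R_i$ be the reflection $q_i\mapsto -q_i$ acting on functions of $q\in\mathbb R^I$, let $n(q)=1/(e^{2\pi q}-1)$, and let $$\hat{\mathcal O}_G=\prod_{i=1}^I\bigl[1+n(q_i)(1-\hat R_i)\bigr],$$ a product of commuting operators. Let $\hat{\mathcal O}_G$ act on $I_G$ through the rational function $P/Q$ that represents $I_G$ for positive $q$ (for any polynomials $P$ and $Q\ne0$ such that $I_G=P/Q$ wherever all $q_i>0$ and $Q(q)\neq 0$). Then $$S_G(q)=\bigl(\hat{\mathcal O}_G I_G\bigr)(q)$$ for every $q$ with all $q_i>0$ such that $Q(\pm q_1,\dots,\pm q_I)\ne0$ for all choices of signs; and for every $q$ with all $q_i>0$, $S_G(q)$ is the limit of $(\hat{\mathcal O}_GI_G)(q')$ as $q'\to q$ through the points $q'$ at which $Q(\pm q_1',\dots,\pm q_I')\neq0$ for all choices of signs (such points exist arbitrarily close to $q$). -/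

import Mathlib

open MeasureTheory Filter Topology

/-- A Matsubara graph with vertex set `V` and set of lines `E`: a connected multigraph without
loops, every vertex of which is an endpoint of at least two lines.  Each line `e` carries a chosen
orientation, from `src e` to `tgt e`; parallel lines are allowed. -/
structure MatsubaraGraph (V E : Type*) [Fintype E] [DecidableEq V] where
  src : E → V
  tgt : E → V
  loopless : ∀ e, src e ≠ tgt e
  connected : (SimpleGraph.fromRel fun a b : V => ∃ e, src e = a ∧ tgt e = b).Connected
  two_le_degree : ∀ v, 2 ≤ (Finset.univ.filter fun e => src e = v ∨ tgt e = v).card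

namespace Matsubara

noncomputable section

variable {V E : Type*} [Fintype V] [DecidableEq V] [Fintype E] [DecidableEq E]

/-- The incidence sign: `1` if the line `e` is oriented into `v`, `-1` if it is oriented away from
`v`, and `0` if `e` is not incident on `v`. -/
def sign (G : MatsubaraGraph V E) (v : V) (e : E) : ℤ :=
  if G.tgt e = v then 1 else if G.src e = v then -1 else 0

/-- The algebraic sum `T_v = ∑ e, s^v_e n_e` of the line variables at the vertex `v`. -/
def flow {R : Type*} [CommRing R] (G : MatsubaraGraph V E) (n : E → R) (v : V) : R :=
  ∑ e, (sign G v e : R) * n e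

/-- The product of Kronecker deltas `∏ v, δ_{T_v, N_v}`. -/
def kroneckerDelta (G : MatsubaraGraph V E) (N : V → ℤ) (n : E → ℤ) : ℝ :=
  ∏ v, if flow G n v = N v then 1 else 0

/-- The product of propagators `∏ e, 1 / (x_e ^ 2 + q_e ^ 2)`. -/
def propagators (q x : E → ℝ) : ℝ :=
  ∏ e, 1 / (x e ^ 2 + q e ^ 2)

/-- The general term of the Matsubara sum. -/
def summand (G : MatsubaraGraph V E) (N : V → ℤ) (q : E → ℝ) (n : E → ℤ) : ℝ :=
  kroneckerDelta G N n * propagators q fun e => (n e : ℝ)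

/-- The Matsubara sum `S_G`, over all `n ∈ ℤ^E`. -/
def matsubaraSum (G : MatsubaraGraph V E) (N : V → ℤ) (q : E → ℝ) : ℝ :=
  ∑' n : E → ℤ, summand G N q n

/-- The lines in `F` carry independent variables: the constraints `T_v = N_v` can be solved,
uniquely, for the variables of the lines outside `F` in terms of arbitrary real values of the
variables of the lines in `F`. -/
def IsIndependentSet (G : MatsubaraGraph V E) (N : V → ℤ) (F : Finset E) : Prop :=
  ∀ y : F → ℝ, ∃! x : E → ℝ, (∀ v, flow G x v = (N v : ℝ)) ∧ ∀ l : F, x l = y l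

/-- The solution of the constraints with prescribed values of the independent variables. -/
def IsIndependentSet.solution {G : MatsubaraGraph V E} {N : V → ℤ} {F : Finset E}
    (hF : IsIndependentSet G N F) (y : F → ℝ) : E → ℝ :=
  (hF y).choose

/-- The Matsubara integral `I_G`: the constraints are eliminated by means of a set `F` of
independent variables, and these are integrated over the real line instead of being summed over
the integers. -/
def matsubaraIntegral {G : MatsubaraGraph V E} {N : V → ℤ} {F : Finset E}
    (hF : IsIndependentSet G N F) (q : E → ℝ) : ℝ :=
  ∫ y : F → ℝ, propagators q (hF.solution y)

/-- The kernel `n(q) = 1 / (e ^ {2 π q} - 1)`. -/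
def bose (q : ℝ) : ℝ :=
  1 / (Real.exp (2 * Real.pi * q) - 1)

/-- The reflection operator `R_i`, acting on functions of the variables `q`. -/
def reflection (i : E) : Module.End ℝ ((E → ℝ) → ℝ) :=
  LinearMap.funLeft ℝ ℝ fun q : E → ℝ => Function.update q i (-q i)

/-- The operator of multiplication by `n(q_i)`. -/
def mulBose (i : E) : Module.End ℝ ((E → ℝ) → ℝ) :=
  LinearMap.mulLeft ℝ fun q : E → ℝ => bose (q i)

/-- The operator `1 + n(q_i) (1 - R_i)`. -/
def lineOperator (i : E) : Module.End ℝ ((E → ℝ) → ℝ) :=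
  1 + mulBose i * (1 - reflection i)

theorem lineOperator_apply (i : E) (f : (E → ℝ) → ℝ) (q : E → ℝ) :
    lineOperator i f q = f q + bose (q i) * (f q - f (Function.update q i (-q i))) := rfl

theorem lineOperator_commute {i j : E} (h : i ≠ j) :
    Commute (lineOperator i) (lineOperator j) := by
  refine LinearMap.ext fun f => funext fun q => ?_
  simp only [Module.End.mul_apply, lineOperator_apply, Function.update_of_ne h,
    Function.update_of_ne h.symm, Function.update_comm h]
  ring

variable (E) in
/-- The operator `O_G = ∏ i, [1 + n(q_i) (1 - R_i)]`; the factors commute. -/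
def matsubaraOperator : Module.End ℝ ((E → ℝ) → ℝ) :=
  Finset.univ.noncommProd lineOperator fun _ _ _ _ h => lineOperator_commute h

/-- The function `P / Q` of the variables `q`. -/
def ratFun (P Q : MvPolynomial E ℝ) (q : E → ℝ) : ℝ :=
  MvPolynomial.eval q P / MvPolynomial.eval q Q

/-- `P / Q` is the rational function of `q` that represents `I` for positive values of `q`
(wherever the denominator does not vanish). -/
def IsRationalForm (I : (E → ℝ) → ℝ) (P Q : MvPolynomial E ℝ) : Prop :=
  Q ≠ 0 ∧ ∀ q : E → ℝ, (∀ e, 0 < q e) → MvPolynomial.eval q Q ≠ 0 → I q = ratFun P Q q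

/-- The points `q` such that `Q` vanishes at none of the points obtained from `q` by changing the
signs of some of the coordinates. -/
def regularPoints (Q : MvPolynomial E ℝ) : Set (E → ℝ) :=
  {q | ∀ A : Finset E, MvPolynomial.eval (fun e => if e ∈ A then -q e else q e) Q ≠ 0}

end

end Matsubara

/-! For |t| ≤ 1 the Fourier series of 1/(n² + q²) sums to (1 + n(q)) (π/q) e^{-2πq|t|} + n(q) (π/q)
e^{2πq|t|}, which is 1 + n(q)(1 - R) applied to (π/q) e^{-2πq|t|}. Writing each Kronecker delta as
the integral of a phase over a period of a vertex time τ_v turns S_G into the operator applied to ∏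
π/q_e times the time integral of `correlation` (`matsubaraSum_eq_sum_integral`). One vertex v₀ stays
at time 0, its constraint being implied by ∑ N_v = 0.

The time integral is elementary once the times are ordered: it is a sum over vertex sets K
containing v₀ of e^{-ω_K} with rational coefficients (`integral_correlation`). As the N_v are
integers, e^{-ω_K} is the product of e^{-2πq_e} over the cut of K, and (1 + n) e^{-2πq} = n trades
this product for a reflection of the cut lines (`weight_mul_exp`). The reflection turns differences
of frequencies into frequencies (`freq_flip_sub_of_subset`), so all exponentials disappear and S_G
is the operator applied to the rational function `timeOrdered` (`sum_weight_mul_periodSum`).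

That `timeOrdered` is I_G follows by scaling (N, q) to (MN, Mq). The constraints have integral
solutions for integral data, so the rescaled sums are Riemann sums of I_G
(`tendsto_scaled_matsubaraSum`). On the other side `timeOrdered` is homogeneous and n(Mq_e) → 0, so
only the unreflected term survives (`matsubaraIntegral_eq_timeOrdered`).

All this needs non-vanishing energy denominators. Density of the generic points, continuity of both
sides, and uniqueness of the rational representation remove the restriction. -/

set_option linter.unusedSectionVars false

namespace Matsubara

noncomputable section

/-! ### Sums over chains of vertex sets -/

section Chains

variable {V : Type*} [DecidableEq V]

/-- The sum over all maximal chains of finite sets from `K` up to `S` of the products of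
`(ω T - ω K)⁻¹`, where `T` runs through the members of the chain other than `K`. -/
def chainSum (ω : Finset V → ℂ) (K : Finset V) : Finset V → ℂ := fun S =>
  if S = K then 1 else (ω S - ω K)⁻¹ * ∑ v ∈ (S \ K).attach, chainSum ω K (S.erase v)
termination_by S => S.card
decreasing_by
  exact Finset.card_erase_lt_of_mem (Finset.mem_sdiff.1 v.2).1

theorem chainSum_self (ω : Finset V → ℂ) (K : Finset V) : chainSum ω K K = 1 := by
  rw [chainSum, if_pos rfl]

theorem chainSum_of_ne (ω : Finset V → ℂ) {K S : Finset V} (h : S ≠ K) :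
    chainSum ω K S = (ω S - ω K)⁻¹ * ∑ v ∈ S \ K, chainSum ω K (S.erase v) := by
  rw [chainSum, if_neg h]
  congr 1
  exact Finset.sum_attach (S \ K) fun v => chainSum ω K (S.erase v)

theorem sub_mul_chainSum {ω : Finset V → ℂ} {K S : Finset V}
    (hω : K ≠ S → ω S ≠ ω K) :
    (ω S - ω K) * chainSum ω K S = ∑ v ∈ S \ K, chainSum ω K (S.erase v) := by
  by_cases h : S = K
  · subst h; simp
  · rw [chainSum_of_ne ω h, mul_inv_cancel_left₀ (sub_ne_zero.2 (hω (Ne.symm h)))]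

/-- Only the differences of the frequencies above `K` matter. -/
theorem chainSum_eq_chainSum_empty {ω ω' : Finset V → ℂ} {K : Finset V}
    (h : ∀ T, K ⊆ T → ω' T - ω' K = ω (T \ K) - ω ∅) (S : Finset V) (hKS : K ⊆ S) :
    chainSum ω' K S = chainSum ω ∅ (S \ K) := by
  induction hn : S.card using Nat.strong_induction_on generalizing S with
  | _ n ih =>
    subst hn
    by_cases hS : S = K
    · subst hS; rw [chainSum_self, sdiff_self, Finset.bot_eq_empty, chainSum_self]
    · have hne : S \ K ≠ ∅ := by
        rw [Ne, Finset.sdiff_eq_empty_iff_subset]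
        exact fun h' => hS (Finset.Subset.antisymm h' hKS)
      rw [chainSum_of_ne _ hS, chainSum_of_ne _ hne, h S hKS, Finset.sdiff_empty]
      congr 1
      refine Finset.sum_congr rfl fun v hv => ?_
      have hv' := Finset.mem_sdiff.1 hv
      rw [ih _ (Finset.card_erase_lt_of_mem hv'.1) _ (Finset.subset_erase.2 ⟨hKS, hv'.2⟩) rfl,
        Finset.erase_sdiff_comm]

variable [Fintype V]

/-- The sum over all maximal chains of finite sets from `S` up to `K` of the products of
`(ω T - ω K)⁻¹`, where `T` runs through the members of the chain other than `K`. -/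
def cochainSum (ω : Finset V → ℂ) (K S : Finset V) : ℂ :=
  chainSum (fun T => ω Tᶜ) Kᶜ Sᶜ

theorem cochainSum_self (ω : Finset V → ℂ) (K : Finset V) : cochainSum ω K K = 1 :=
  chainSum_self _ _

theorem cochainSum_of_ne (ω : Finset V → ℂ) {K S : Finset V} (h : S ≠ K) :
    cochainSum ω K S = (ω S - ω K)⁻¹ * ∑ v ∈ K \ S, cochainSum ω K (insert v S) := by
  rw [cochainSum, chainSum_of_ne _ (by simpa using h)]
  simp only [compl_compl]
  congr 1
  refine Finset.sum_congr (by ext; simp [and_comm]) fun v _ => ?_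
  rw [cochainSum, Finset.compl_insert]

theorem sub_mul_cochainSum {ω : Finset V → ℂ} {K S : Finset V}
    (hω : S ≠ K → ω S ≠ ω K) :
    (ω S - ω K) * cochainSum ω K S = ∑ v ∈ K \ S, cochainSum ω K (insert v S) := by
  by_cases h : S = K
  · subst h; simp
  · rw [cochainSum_of_ne ω h, mul_inv_cancel_left₀ (sub_ne_zero.2 (hω h))]

theorem cochainSum_eq_cochainSum_univ {ω ω' : Finset V → ℂ} {K : Finset V}
    (h : ∀ T, T ⊆ K → ω' T - ω' K = ω (Kᶜ ∪ T) - ω Finset.univ) (S : Finset V) (hSK : S ⊆ K) :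
    cochainSum ω' K S = cochainSum ω Finset.univ (Kᶜ ∪ S) := by
  rw [cochainSum, cochainSum, chainSum_eq_chainSum_empty (ω := fun T => ω Tᶜ) _ _
    (Finset.compl_subset_compl.2 hSK)]
  · rw [Finset.compl_univ]
    congr 1
    ext; simp [and_comm]
  · intro T hT
    have hT' : Tᶜ ⊆ K := by
      rw [← compl_compl K]; exact Finset.compl_subset_compl.2 hT
    have e : (T \ Kᶜ)ᶜ = Kᶜ ∪ Tᶜ := by ext; simp [or_comm]
    rw [compl_compl, h _ hT', e, Finset.compl_empty]

/-- Along one chain S₀ = T₀ ⊂ … ⊂ T_k = S, the sum over j of ∏_{i ≠ j} (ω T_i - ω T_j)⁻¹ is up to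
sign the divided difference of the constant 1, which is zero for k ≥ 1; here this is summed over all
maximal chains. The induction splits ω S - ω S₀ as (ω S - ω K) - (ω S₀ - ω K): the first factor
removes the top link of the chain, the second the bottom link. -/
theorem sum_cochainSum_mul_chainSum {ω : Finset V → ℂ} (S₀ S : Finset V) (hss : S₀ ⊂ S)
    (hω : ∀ T T', S₀ ⊆ T → T ⊂ T' → T' ⊆ S → ω T' ≠ ω T) :
    ∑ K ∈ Finset.Icc S₀ S, cochainSum ω K S₀ * chainSum ω K S = 0 := by
  induction hn : (S \ S₀).card using Nat.strong_induction_on generalizing S₀ S with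
  | _ n ih =>
    subst hn
    have h1 : ∑ K ∈ Finset.Icc S₀ S, cochainSum ω K S₀ * ((ω S - ω K) * chainSum ω K S) =
        ∑ v ∈ S \ S₀, ∑ K ∈ Finset.Icc S₀ (S.erase v),
          cochainSum ω K S₀ * chainSum ω K (S.erase v) := by
      rw [Finset.sum_comm' (t' := Finset.Icc S₀ S) (s' := fun K => S \ K)]
      · refine Finset.sum_congr rfl fun K hK => ?_
        obtain ⟨h1, h2⟩ := Finset.mem_Icc.1 hK
        rw [sub_mul_chainSum (fun hne => hω K S h1 (h2.ssubset_of_ne hne) subset_rfl),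
          Finset.mul_sum]
      · intro v K
        simp only [Finset.mem_sdiff, Finset.mem_Icc, Finset.subset_erase]
        constructor
        · rintro ⟨⟨a, b⟩, c, d, e⟩; exact ⟨⟨a, e⟩, c, d⟩
        · rintro ⟨⟨a, b⟩, c, d⟩; exact ⟨⟨a, fun h => b (c h)⟩, c, d, b⟩
    have h2 : ∑ K ∈ Finset.Icc S₀ S, ((ω S₀ - ω K) * cochainSum ω K S₀) * chainSum ω K S =
        ∑ v ∈ S \ S₀, ∑ K ∈ Finset.Icc (insert v S₀) S,
          cochainSum ω K (insert v S₀) * chainSum ω K S := by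
      rw [Finset.sum_comm' (t' := Finset.Icc S₀ S) (s' := fun K => K \ S₀)]
      · refine Finset.sum_congr rfl fun K hK => ?_
        obtain ⟨h1, h2⟩ := Finset.mem_Icc.1 hK
        rw [sub_mul_cochainSum (fun hne => (hω S₀ K subset_rfl (h1.ssubset_of_ne hne) h2).symm),
          Finset.sum_mul]
      · intro v K
        simp only [Finset.mem_sdiff, Finset.mem_Icc,
          Finset.insert_subset_iff]
        constructor
        · rintro ⟨⟨a, b⟩, ⟨c, d⟩, e⟩; exact ⟨⟨c, b⟩, d, e⟩
        · rintro ⟨⟨a, b⟩, c, d⟩; exact ⟨⟨d a, b⟩, ⟨a, c⟩, d⟩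
    have h3 : (ω S - ω S₀) * ∑ K ∈ Finset.Icc S₀ S, cochainSum ω K S₀ * chainSum ω K S =
        ∑ v ∈ S \ S₀, (∑ K ∈ Finset.Icc S₀ (S.erase v),
          cochainSum ω K S₀ * chainSum ω K (S.erase v) -
          ∑ K ∈ Finset.Icc (insert v S₀) S,
            cochainSum ω K (insert v S₀) * chainSum ω K S) := by
      rw [Finset.sum_sub_distrib, ← h1, ← h2, ← Finset.sum_sub_distrib, Finset.mul_sum]
      refine Finset.sum_congr rfl fun K _ => ?_
      ring
    -- Both sums vanish by induction, unless S = insert v S₀, when both are equal to 1.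
    have h4 : ∀ v ∈ S \ S₀, ∑ K ∈ Finset.Icc S₀ (S.erase v),
          cochainSum ω K S₀ * chainSum ω K (S.erase v) =
          ∑ K ∈ Finset.Icc (insert v S₀) S,
            cochainSum ω K (insert v S₀) * chainSum ω K S := by
      intro v hv
      obtain ⟨hvS, hv0⟩ := Finset.mem_sdiff.1 hv
      by_cases hsing : S = insert v S₀
      · subst hsing
        rw [Finset.erase_insert hv0]
        simp [cochainSum_self, chainSum_self]
      · have c1 : (S.erase v \ S₀).card < (S \ S₀).card := by
          rw [Finset.erase_sdiff_comm]; exact Finset.card_erase_lt_of_mem hv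
        have c2 : (S \ insert v S₀).card < (S \ S₀).card := by
          rw [Finset.sdiff_insert]
          exact Finset.card_erase_lt_of_mem hv
        have hins : insert v S₀ ⊂ S :=
          (Finset.insert_subset hvS hss.1).ssubset_of_ne (Ne.symm hsing)
        have her : S₀ ⊂ S.erase v := by
          refine (Finset.subset_erase.2 ⟨hss.1, hv0⟩).ssubset_of_ne fun h => hsing ?_
          rw [h, Finset.insert_erase hvS]
        rw [ih _ c1 _ _ her (fun T T' a b c => hω T T' a b (c.trans (Finset.erase_subset _ _))) rfl,
          ih _ c2 _ _ hins
            (fun T T' a b c => hω T T' ((Finset.subset_insert _ _).trans a) b c) rfl]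
    rw [Finset.sum_eq_zero fun v hv => sub_eq_zero.2 (h4 v hv)] at h3
    exact (mul_eq_zero.1 h3).resolve_left
      (sub_ne_zero.2 (hω S₀ S subset_rfl hss subset_rfl))

end Chains

/-! ### Expansion of the operator over sets of reflected lines -/

section Flips

variable {E : Type*} [DecidableEq E]

/-- Change the signs of the coordinates in `A`. -/
def flip (A : Finset E) (q : E → ℝ) : E → ℝ := fun e => if e ∈ A then -q e else q e

theorem flip_flip (A B : Finset E) (q : E → ℝ) : flip A (flip B q) = flip (symmDiff A B) q := by
  funext e
  by_cases hA : e ∈ A <;> by_cases hB : e ∈ B <;> simp [flip, Finset.mem_symmDiff, hA, hB]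

theorem flip_empty (q : E → ℝ) : flip ∅ q = q := by
  funext e; simp [flip]

theorem continuous_flip (A : Finset E) : Continuous (flip A) := by
  refine continuous_pi fun e => ?_
  unfold flip
  split_ifs <;> fun_prop

/-- The coefficient with which the function `q ↦ f (flip A q)` occurs in the operator built from
the lines in `s`. -/
def weight (s : Finset E) (q : E → ℝ) (A : Finset E) : ℝ :=
  ∏ e ∈ s, if e ∈ A then -bose (q e) else 1 + bose (q e)

variable [Fintype E]

/-- Here A is the set of lines at which the reflection is chosen. The induction closes because the
weight on `s` does not involve the coordinate `a` that is being reflected. -/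
theorem noncommProd_lineOperator_apply (s : Finset E)
    (h : (s : Set E).Pairwise (Function.onFun Commute (lineOperator (E := E))))
    (f : (E → ℝ) → ℝ) (q : E → ℝ) :
    s.noncommProd lineOperator h f q =
      ∑ A ∈ s.powerset, weight s q A * f (flip A q) := by
  induction s using Finset.induction_on generalizing q with
  | empty => rw [Finset.noncommProd_empty]; simp [weight, flip_empty]
  | insert a s ha ih =>
    rw [Finset.noncommProd_insert_of_notMem _ _ _ _ ha, Module.End.mul_apply, lineOperator_apply,
      ih, ih, Finset.sum_powerset_insert ha]
    have hA : ∀ A ∈ s.powerset, a ∉ A := fun A hA h => ha (Finset.mem_powerset.1 hA h)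
    have h1 : ∀ A ∈ s.powerset, weight (insert a s) q A * f (flip A q) =
        (1 + bose (q a)) * (weight s q A * f (flip A q)) := by
      intro A h
      rw [weight, Finset.prod_insert ha, if_neg (hA A h), weight, mul_assoc]
    have h2 : ∀ A ∈ s.powerset, weight (insert a s) q (insert a A) * f (flip (insert a A) q) =
        (-bose (q a)) * (weight s (Function.update q a (-q a)) A *
          f (flip A (Function.update q a (-q a)))) := by
      intro A h
      have e1 : flip (insert a A) q = flip A (Function.update q a (-q a)) := by
        funext e
        by_cases he : e = a
        · subst he; simp [flip, hA A ‹_›]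
        · simp [flip, he]
      rw [weight, Finset.prod_insert ha, if_pos (Finset.mem_insert_self _ _), weight, mul_assoc, e1]
      congr 2
      refine Finset.prod_congr rfl fun e he => ?_
      have : e ≠ a := fun h => ha (h ▸ he)
      simp [Finset.mem_insert, this]
    rw [Finset.sum_congr rfl h1, Finset.sum_congr rfl h2, ← Finset.mul_sum, ← Finset.mul_sum]
    ring

theorem matsubaraOperator_apply (f : (E → ℝ) → ℝ) (q : E → ℝ) :
    matsubaraOperator E f q = ∑ A : Finset E, weight Finset.univ q A * f (flip A q) := by
  rw [← Finset.powerset_univ]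
  exact noncommProd_lineOperator_apply _ _ f q

theorem continuousAt_bose {q : ℝ} (hq : 0 < q) : ContinuousAt bose q := by
  have : Real.exp (2 * Real.pi * q) - 1 ≠ 0 :=
    (sub_pos.2 (Real.one_lt_exp_iff.2 (by positivity))).ne'
  unfold bose
  fun_prop (disch := assumption)

theorem continuousAt_weight {q : E → ℝ} (hq : ∀ e, 0 < q e) (A : Finset E) :
    ContinuousAt (fun q => weight Finset.univ q A) q := by
  unfold weight
  refine tendsto_finsetProd _ fun e _ => ?_
  have h : ContinuousAt (fun q : E → ℝ => bose (q e)) q :=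
    ContinuousAt.comp (f := fun q : E → ℝ => q e) (continuousAt_bose (hq e))
      (continuous_apply e).continuousAt
  split_ifs
  · exact h.neg
  · exact continuousAt_const.add h

end Flips

/-! ### Cuts, frequencies, and the exchange of exponentials for reflections -/

section Cuts

variable {V E : Type*} [DecidableEq V] [Fintype E] [DecidableEq E]

/-- The lines with exactly one end in `K`. -/
def cut (G : MatsubaraGraph V E) (K : Finset V) : Finset E :=
  Finset.univ.filter fun e => ¬(G.src e ∈ K ↔ G.tgt e ∈ K)

/-- The sum of `q` over the lines with exactly one end in `K`. -/
def cutSum (G : MatsubaraGraph V E) (K : Finset V) (q : E → ℝ) : ℝ :=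
  ∑ e ∈ cut G K, q e

/-- The complex frequency of the intermediate state in which exactly the vertices of `K` have
been passed. -/
def freq (G : MatsubaraGraph V E) (N : V → ℤ) (q : E → ℝ) (K : Finset V) : ℂ :=
  2 * Real.pi * (cutSum G K q - Complex.I * ∑ v ∈ K, (N v : ℂ))

theorem cutSum_eq (G : MatsubaraGraph V E) (K : Finset V) (q : E → ℝ) :
    cutSum G K q = ∑ e, if (G.src e ∈ K ↔ G.tgt e ∈ K) then 0 else q e := by
  rw [cutSum, cut, Finset.sum_filter]
  exact Finset.sum_congr rfl fun e _ => by split_ifs <;> simp_all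

theorem freq_empty (G : MatsubaraGraph V E) (N : V → ℤ) (q : E → ℝ) : freq G N q ∅ = 0 := by
  simp [freq, cutSum_eq]

theorem freq_re (G : MatsubaraGraph V E) (N : V → ℤ) (q : E → ℝ) (K : Finset V) :
    (freq G N q K).re = 2 * Real.pi * cutSum G K q := by
  have : (∑ v ∈ K, (N v : ℂ)) = ((∑ v ∈ K, N v : ℤ) : ℂ) := by push_cast; rfl
  rw [freq, this]
  simp

/-- Lines from K to S \ K lie only in the cut of K and enter as -(-q). Lines from K to the outside
of S lie in both cuts and cancel. Lines from S \ K to the outside of S enter as q. What remains is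
the cut of S \ K. -/
theorem cutSum_flip_sub_of_subset (G : MatsubaraGraph V E) (q : E → ℝ) {K S : Finset V}
    (h : K ⊆ S) : cutSum G S (flip (cut G K) q) - cutSum G K (flip (cut G K) q) =
      cutSum G (S \ K) q := by
  simp only [cutSum_eq, ← Finset.sum_sub_distrib]
  refine Finset.sum_congr rfl fun e _ => ?_
  have h1 : G.src e ∈ K → G.src e ∈ S := fun h' => h h'
  have h2 : G.tgt e ∈ K → G.tgt e ∈ S := fun h' => h h'
  by_cases a : G.src e ∈ K <;> by_cases b : G.tgt e ∈ K <;>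
    by_cases c : G.src e ∈ S <;> by_cases d : G.tgt e ∈ S <;>
    simp_all [flip, cut, Finset.mem_sdiff]

theorem freq_flip_sub_of_subset (G : MatsubaraGraph V E) (N : V → ℤ) (q : E → ℝ)
    {K S : Finset V} (h : K ⊆ S) : freq G N (flip (cut G K) q) S - freq G N (flip (cut G K) q) K =
      freq G N q (S \ K) := by
  have h1 := congrArg (fun x : ℝ => (x : ℂ)) (cutSum_flip_sub_of_subset G q h)
  have h2 := Finset.sum_sdiff (f := fun v => (N v : ℂ)) h
  simp only [Complex.ofReal_sub] at h1
  rw [freq, freq, freq, ← h1, ← h2]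
  ring

variable [Fintype V]

theorem cutSum_compl (G : MatsubaraGraph V E) (q : E → ℝ) (K : Finset V) :
    cutSum G Kᶜ q = cutSum G K q := by
  simp only [cutSum_eq, Finset.mem_compl, not_iff_not]

theorem freq_univ (G : MatsubaraGraph V E) {N : V → ℤ} (hN : ∑ v, N v = 0) (q : E → ℝ) :
    freq G N q Finset.univ = 0 := by
  have : (∑ v, (N v : ℂ)) = 0 := by exact_mod_cast hN
  rw [freq, this]; simp [cutSum_eq]

/-- The mirror image below K. The remaining lines form the cut of K \ S, which is also the cut of
its complement Kᶜ ∪ S; passing to the complement repairs the sign of the N-term, because the N_v sum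
to zero. -/
theorem freq_flip_sub_of_subset' (G : MatsubaraGraph V E) {N : V → ℤ} (hN : ∑ v, N v = 0)
    (q : E → ℝ) {K S : Finset V} (h : S ⊆ K) :
    freq G N (flip (cut G K) q) S - freq G N (flip (cut G K) q) K = freq G N q (Kᶜ ∪ S) := by
  have hc : (K \ S)ᶜ = Kᶜ ∪ S := by ext; simp [imp_iff_not_or]
  have hN' : (∑ v, (N v : ℂ)) = 0 := by exact_mod_cast hN
  have h1 : cutSum G S (flip (cut G K) q) - cutSum G K (flip (cut G K) q) =
      cutSum G (Kᶜ ∪ S) q := by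
    rw [← hc, cutSum_compl]
    simp only [cutSum_eq, ← Finset.sum_sub_distrib]
    refine Finset.sum_congr rfl fun e _ => ?_
    have h1 : G.src e ∈ S → G.src e ∈ K := fun h' => h h'
    have h2 : G.tgt e ∈ S → G.tgt e ∈ K := fun h' => h h'
    by_cases a : G.src e ∈ K <;> by_cases b : G.tgt e ∈ K <;>
      by_cases c : G.src e ∈ S <;> by_cases d : G.tgt e ∈ S <;>
      simp_all [flip, cut, Finset.mem_sdiff]
  have h2 := Finset.sum_sdiff (f := fun v => (N v : ℂ)) h
  have h3 := Finset.sum_add_sum_compl (K \ S) (fun v => (N v : ℂ))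
  rw [hN', hc] at h3
  have h1' := congrArg (fun x : ℝ => (x : ℂ)) h1
  simp only [Complex.ofReal_sub] at h1'
  rw [freq, freq, freq, ← h1', ← h2, eq_neg_of_add_eq_zero_right h3]
  ring

/-- The sum over all orders in time of the vertices of the products of the inverse frequencies of
the intermediate states; `K` consists of `v₀` and the vertices later than `v₀`. -/
def timeOrderedSum (G : MatsubaraGraph V E) (N : V → ℤ) (v₀ : V) (q : E → ℝ) : ℂ :=
  ∑ K ∈ Finset.Icc {v₀} Finset.univ, cochainSum (freq G N q) Finset.univ (Kᶜ ∪ {v₀}) *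
    chainSum (freq G N q) ∅ (Finset.univ \ K)

/-- The rational function that represents the Matsubara integral. -/
def timeOrdered (G : MatsubaraGraph V E) (N : V → ℤ) (v₀ : V) (q : E → ℝ) : ℂ :=
  (∏ e, (Real.pi / q e : ℂ)) * timeOrderedSum G N v₀ q

/-- The integral over a period of length `1` of the product of the exponentials attached to the
lines and vertices; see `integral_correlation_univ`. -/
def periodSum (G : MatsubaraGraph V E) (N : V → ℤ) (v₀ : V) (q : E → ℝ) : ℂ :=
  ∑ K ∈ Finset.Icc {v₀} Finset.univ, Complex.exp (-freq G N q K) *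
    (cochainSum (freq G N q) K {v₀} * chainSum (freq G N q) K Finset.univ)

theorem chainSum_flip (G : MatsubaraGraph V E) (N : V → ℤ) (q : E → ℝ) {K S : Finset V}
    (h : K ⊆ S) :
    chainSum (freq G N (flip (cut G K) q)) K S = chainSum (freq G N q) ∅ (S \ K) :=
  chainSum_eq_chainSum_empty
    (fun T hT => by rw [freq_flip_sub_of_subset G N q hT, freq_empty, sub_zero]) S h

theorem cochainSum_flip (G : MatsubaraGraph V E) {N : V → ℤ} (hN : ∑ v, N v = 0) (q : E → ℝ)
    {K S : Finset V} (h : S ⊆ K) :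
    cochainSum (freq G N (flip (cut G K) q)) K S =
      cochainSum (freq G N q) Finset.univ (Kᶜ ∪ S) :=
  cochainSum_eq_cochainSum_univ
    (fun T hT => by rw [freq_flip_sub_of_subset' G hN q hT, freq_univ G hN, sub_zero]) S h

/-- The property of the kernel that allows an exponential to be exchanged for a reflection. -/
theorem one_add_bose_mul_exp {q : ℝ} (hq : q ≠ 0) :
    (1 + bose q) * Real.exp (-(2 * Real.pi * q)) = bose q := by
  have h : Real.exp (2 * Real.pi * q) - 1 ≠ 0 := by
    rw [sub_ne_zero, Ne, Real.exp_eq_one_iff]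
    have := Real.pi_pos.ne'
    simp [hq]
  rw [bose, Real.exp_neg]
  field_simp
  ring

/-- The N_v are integers, so the phase is a power of e^{2πi} and drops out. -/
theorem exp_neg_freq (G : MatsubaraGraph V E) (N : V → ℤ) (q : E → ℝ) (K : Finset V) :
    Complex.exp (-freq G N q K) =
      ((∏ e ∈ cut G K, Real.exp (-(2 * Real.pi * q e)) : ℝ) : ℂ) := by
  have : -freq G N q K = ((∑ e ∈ cut G K, -(2 * Real.pi * q e) : ℝ) : ℂ) +
      (∑ v ∈ K, N v : ℤ) * (2 * Real.pi * Complex.I) := by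
    rw [freq, cutSum, Finset.sum_neg_distrib, ← Finset.mul_sum]
    push_cast
    ring
  rw [this, Complex.exp_add, Complex.exp_int_mul_two_pi_mul_I, mul_one, ← Real.exp_sum,
    Complex.ofReal_exp]

/-- The identity holds line by line. On a line of C the exponential turns 1 + n into n, or n into 1
+ n if the line is already reflected; the sign of -n is absorbed by the sign change of π/q. -/
theorem weight_mul_exp (q : E → ℝ) (hq : ∀ e, q e ≠ 0) (A C : Finset E) :
    weight Finset.univ q A * (∏ e ∈ C, Real.exp (-(2 * Real.pi * flip A q e))) *
        ∏ e, (Real.pi / flip A q e) =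
      weight Finset.univ q (symmDiff A C) * ∏ e, (Real.pi / flip (symmDiff A C) q e) := by
  have h0 : (∏ e ∈ C, Real.exp (-(2 * Real.pi * flip A q e))) =
      ∏ e, if e ∈ C then Real.exp (-(2 * Real.pi * flip A q e)) else 1 := by
    rw [Finset.prod_ite_mem, Finset.univ_inter]
  rw [h0, weight, weight, ← Finset.prod_mul_distrib, ← Finset.prod_mul_distrib,
    ← Finset.prod_mul_distrib]
  refine Finset.prod_congr rfl fun e _ => ?_
  have h1 := one_add_bose_mul_exp (hq e)
  have h2 : bose (q e) * Real.exp (2 * Real.pi * q e) = 1 + bose (q e) := by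
    conv_lhs => rw [← h1, mul_assoc, ← Real.exp_add]
    simp
  by_cases hA : e ∈ A <;> by_cases hC : e ∈ C <;>
    simp only [flip, Finset.mem_symmDiff, hA, hC, if_true, if_false, not_true, not_false_eq_true,
      and_true, and_false, or_false, or_true, mul_one, mul_neg, neg_neg]
  · rw [neg_mul, h2, div_neg]; ring
  · rw [h1, div_neg]; ring

/-- Under the operator, the period sum may be replaced by the sum over all time orders. -/
theorem sum_weight_mul_periodSum (G : MatsubaraGraph V E) {N : V → ℤ} (hN : ∑ v, N v = 0) (v₀ : V)
    (q : E → ℝ) (hq : ∀ e, q e ≠ 0) :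
    ∑ A : Finset E, (weight Finset.univ q A : ℂ) *
        ((∏ e, (Real.pi / flip A q e : ℂ)) * periodSum G N v₀ (flip A q)) =
      ∑ A : Finset E, (weight Finset.univ q A : ℂ) * timeOrdered G N v₀ (flip A q) := by
  simp only [periodSum, timeOrdered, timeOrderedSum, Finset.mul_sum]
  rw [Finset.sum_comm, Finset.sum_comm (s := Finset.univ)]
  refine Finset.sum_congr rfl fun K hK => ?_
  have hK' : {v₀} ⊆ K := (Finset.mem_Icc.1 hK).1
  -- For fixed K, taking the symmetric difference with the cut of K is an involution on the sets of
  -- reflected lines, and it matches the two sums term by term.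
  refine Finset.sum_nbij' (fun A => symmDiff A (cut G K)) (fun A => symmDiff A (cut G K))
    (fun _ _ => Finset.mem_univ _) (fun _ _ => Finset.mem_univ _) (fun A _ => by simp)
    (fun A _ => by simp) fun A _ => ?_
  have hflip : flip A q = flip (cut G K) (flip (symmDiff A (cut G K)) q) := by
    rw [flip_flip, symmDiff_comm A, symmDiff_symmDiff_cancel_left]
  have hw := congrArg (fun x : ℝ => (x : ℂ)) (weight_mul_exp q hq A (cut G K))
  simp only [Complex.ofReal_mul, Complex.ofReal_prod, Complex.ofReal_div] at hw
  rw [exp_neg_freq]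
  simp only [Complex.ofReal_prod]
  rw [← mul_assoc (weight _ _ (symmDiff A (cut G K)) : ℂ), ← hw, ← cochainSum_flip G hN _ hK',
    ← chainSum_flip G N _ (Finset.subset_univ K), ← hflip]
  ring

end Cuts

/-! ### Fubini for one coordinate of a product measure -/

section ProductMeasures

variable {ι : Type*} [Fintype ι] [DecidableEq ι]

theorem sigmaFinite_update (μ : ι → Measure ℝ) [∀ i, SigmaFinite (μ i)] (i : ι) (ν : Measure ℝ)
    [SigmaFinite ν] (j : ι) : SigmaFinite (Function.update μ i ν j) := by
  by_cases h : j = i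
  · subst h; simpa
  · rw [Function.update_of_ne h]; infer_instance

theorem measurable_update_pair (i : ι) :
    Measurable fun p : ℝ × (ι → ℝ) => Function.update p.2 i p.1 := by
  refine measurable_pi_lambda _ fun j => ?_
  by_cases h : j = i
  · subst h; simpa using measurable_fst
  · simp only [Function.update_of_ne h]
    exact (measurable_pi_apply j).comp measurable_snd

/-- A product measure is reconstructed from one of its factors and the product of the others. -/
theorem map_update_prod (μ : ι → Measure ℝ) [∀ i, SigmaFinite (μ i)] (i : ι) :
    ((μ i).prod (Measure.pi (Function.update μ i (Measure.dirac 0)))).map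
      (fun p => Function.update p.2 i p.1) = Measure.pi μ := by
  have := sigmaFinite_update μ i (Measure.dirac 0)
  symm
  refine Measure.pi_eq fun s hs => ?_
  rw [Measure.map_apply (measurable_update_pair i) (MeasurableSet.univ_pi hs)]
  have h : (fun p : ℝ × (ι → ℝ) => Function.update p.2 i p.1) ⁻¹' Set.pi Set.univ s =
      s i ×ˢ Set.pi Set.univ (Function.update s i Set.univ) := by
    ext p
    simp only [Set.mem_preimage, Set.mem_pi, Set.mem_univ, true_imp_iff, Set.mem_prod]
    constructor
    · refine fun h => ⟨by simpa using h i, fun j => ?_⟩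
      by_cases hj : j = i
      · subst hj; simp
      · simpa [hj] using h j
    · rintro ⟨h1, h2⟩ j
      by_cases hj : j = i
      · subst hj; simpa
      · simpa [hj] using h2 j
  rw [h, Measure.prod_prod, Measure.pi_pi, ← Finset.mul_prod_erase _ _ (Finset.mem_univ i),
    ← Finset.mul_prod_erase Finset.univ (fun j => μ j (s j)) (Finset.mem_univ i)]
  simp only [Function.update_self, measure_univ, one_mul]
  congr 1
  refine Finset.prod_congr rfl fun j hj => ?_
  simp [Finset.ne_of_mem_erase hj]

/-- A point mass at `i` plays the role of a deleted coordinate, so that all integrals live on the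
same space; its position can be moved into the integrand. -/
theorem integral_pi_update_dirac (μ : ι → Measure ℝ) [∀ i, SigmaFinite (μ i)] (i : ι) (s : ℝ)
    {g : (ι → ℝ) → ℂ} (hg : Measurable g) :
    ∫ x, g x ∂Measure.pi (Function.update μ i (Measure.dirac s)) =
      ∫ x, g (Function.update x i s) ∂Measure.pi (Function.update μ i (Measure.dirac 0)) := by
  have h1 := sigmaFinite_update μ i (Measure.dirac s)
  have h2 := sigmaFinite_update μ i (Measure.dirac 0)
  rw [← map_update_prod (Function.update μ i (Measure.dirac s)) i, Function.update_self,
    Function.update_idem, Measure.dirac_prod,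
    Measure.map_map (measurable_update_pair i) (measurable_prodMk_left),
    integral_map ((measurable_update_pair i).comp measurable_prodMk_left).aemeasurable
      hg.aestronglyMeasurable]
  rfl

/-- Integration with respect to a product measure, one coordinate first. -/
theorem integral_pi_eq_integral_integral (μ : ι → Measure ℝ) [∀ i, SigmaFinite (μ i)] (i : ι)
    {f : ℝ → (ι → ℝ) → ℂ} (hf : ∀ s, Measurable (f s))
    (hint : Integrable (fun x => f (x i) x) (Measure.pi μ)) :
    ∫ x, f (x i) x ∂Measure.pi μ =
      ∫ s, ∫ x, f s x ∂Measure.pi (Function.update μ i (Measure.dirac s)) ∂μ i := by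
  have := sigmaFinite_update μ i (Measure.dirac 0)
  simp_rw [fun s => integral_pi_update_dirac μ i s (hf s)]
  rw [← map_update_prod μ i] at hint ⊢
  have h := (integrable_map_measure hint.1 (measurable_update_pair i).aemeasurable).1 hint
  rw [integral_map (measurable_update_pair i).aemeasurable hint.1]
  refine (integral_prod _ h).trans ?_
  simp

theorem ae_pi_of_forall_ae {μ : ι → Measure ℝ} [∀ i, SigmaFinite (μ i)] {p : ι → ℝ → Prop}
    (h : ∀ i, ∀ᵐ x ∂μ i, p i x) : ∀ᵐ x ∂Measure.pi μ, ∀ i, p i (x i) :=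
  ae_all_iff.2 fun i => Measure.tendsto_eval_ae_ae.eventually (h i)

/-- Once x i is fixed, the condition x i = x j cuts out a hyperplane in the coordinate j, which is
null when μ j has no atoms. -/
theorem ae_pi_ne {μ : ι → Measure ℝ} [∀ i, SigmaFinite (μ i)] {i j : ι} (hij : i ≠ j)
    [NullSingletonClass (μ j)] : ∀ᵐ x ∂Measure.pi μ, x i ≠ x j := by
  have hσ := sigmaFinite_update μ i (Measure.dirac 0)
  have hm : MeasurableSet {x : ι → ℝ | x i = x j} :=
    measurableSet_eq_fun (measurable_pi_apply i) (measurable_pi_apply j)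
  rw [ae_iff]
  simp only [not_not]
  rw [← map_update_prod μ i, Measure.map_apply (measurable_update_pair i) hm,
    Measure.measure_prod_null (measurable_update_pair i hm)]
  refine Eventually.of_forall fun s => ?_
  have hna : NullSingletonClass (Function.update μ i (Measure.dirac 0) j) := by
    rw [Function.update_of_ne hij.symm]; infer_instance
  refine measure_mono_null ?_ (Measure.pi_hyperplane (μ := Function.update μ i (Measure.dirac 0)) j s)
  intro x hx
  simp only [Set.mem_preimage, Set.mem_ofPred_eq, Function.update_self,
    Function.update_of_ne hij.symm] at hx ⊢
  exact hx.symm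

theorem pi_dirac (x : ι → ℝ) : Measure.pi (fun i => Measure.dirac (x i)) = Measure.dirac x := by
  refine Measure.pi_eq fun s hs => ?_
  rw [Measure.dirac_apply' _ (MeasurableSet.univ_pi hs)]
  by_cases h : x ∈ Set.pi Set.univ s
  · rw [Set.indicator_of_mem h, Pi.one_apply, Finset.prod_eq_one]
    intro i _
    rw [Measure.dirac_apply' _ (hs i), Set.indicator_of_mem (h i trivial), Pi.one_apply]
  · rw [Set.indicator_of_notMem h]
    obtain ⟨i, hi⟩ : ∃ i, x i ∉ s i := by simpa [Set.mem_pi] using h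
    rw [Finset.prod_eq_zero (Finset.mem_univ i)]
    rw [Measure.dirac_apply' _ (hs i), Set.indicator_of_notMem hi]

end ProductMeasures

theorem ite_eq_indicator {α : Type*} (p : α → Prop) [DecidablePred p] (f : α → ℂ) :
    (fun x => if p x then f x else 0) = {x | p x}.indicator f := by
  funext x
  by_cases h : p x <;> simp [h]

/-! ### The integral over the vertex times -/

section Correlation

variable {V E : Type*} [Fintype V] [DecidableEq V] [Fintype E] [DecidableEq E]

/-- The distribution of the time of the vertex `v`: the vertex `v₀` sits at time `0`, the times of
the other vertices in `S` are distributed uniformly over `(0, t]`, and the vertices outside `S`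
sit at time `t`. -/
def vertexTime (v₀ : V) (S : Finset V) (t : ℝ) (v : V) : Measure ℝ :=
  if v = v₀ then Measure.dirac 0 else if v ∈ S then volume.restrict (Set.Ioc 0 t)
    else Measure.dirac t

instance isFiniteMeasure_vertexTime (v₀ : V) (S : Finset V) (t : ℝ) (v : V) :
    IsFiniteMeasure (vertexTime v₀ S t v) := by
  unfold vertexTime
  split_ifs
  · infer_instance
  · infer_instance
  · infer_instance

/-- The product of the exponentials attached to the lines and the vertices, as a function of the
times of the vertices. -/
def correlation (G : MatsubaraGraph V E) (N : V → ℤ) (q : E → ℝ) (τ : V → ℝ) : ℂ :=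
  Complex.exp (-(2 * Real.pi * (((∑ e, q e * |τ (G.tgt e) - τ (G.src e)| : ℝ) : ℂ) +
    Complex.I * ∑ v, (N v : ℂ) * τ v)))

theorem continuous_correlation (G : MatsubaraGraph V E) (N : V → ℤ) (q : E → ℝ) :
    Continuous (correlation G N q) := by
  unfold correlation
  fun_prop

theorem ae_vertexTime_mem_Icc (v₀ : V) (S : Finset V) {t : ℝ} (ht : 0 ≤ t) (v : V) :
    ∀ᵐ x ∂vertexTime v₀ S t v, x ∈ Set.Icc 0 t := by
  unfold vertexTime
  split_ifs
  · rw [ae_dirac_eq, eventually_pure]; exact ⟨le_rfl, ht⟩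
  · filter_upwards [ae_restrict_mem measurableSet_Ioc] with x hx using ⟨hx.1.le, hx.2⟩
  · rw [ae_dirac_eq, eventually_pure]; exact ⟨ht, le_rfl⟩

theorem integrable_correlation (G : MatsubaraGraph V E) (N : V → ℤ) (q : E → ℝ) (v₀ : V)
    (S : Finset V) {t : ℝ} (ht : 0 ≤ t) :
    Integrable (correlation G N q) (Measure.pi (vertexTime v₀ S t)) := by
  have hK : IsCompact (Set.pi Set.univ fun _ : V => Set.Icc (0 : ℝ) t) :=
    isCompact_univ_pi fun _ => isCompact_Icc
  have h : IntegrableOn (correlation G N q) (Set.pi Set.univ fun _ : V => Set.Icc (0 : ℝ) t)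
      (Measure.pi (vertexTime v₀ S t)) :=
    (continuous_correlation G N q).continuousOn.integrableOn_compact hK
  rwa [IntegrableOn, Measure.restrict_eq_self_of_ae_mem] at h
  filter_upwards [ae_pi_of_forall_ae fun v => ae_vertexTime_mem_Icc v₀ S ht v] with τ hτ v _
    using hτ v

/-- Moving the vertices outside `S` to later times. -/
theorem correlation_shift (G : MatsubaraGraph V E) {N : V → ℤ} (hN : ∑ v, N v = 0) (q : E → ℝ)
    (S : Finset V) {h : ℝ} (hh : 0 ≤ h) {τ : V → ℝ} (hτ : ∀ v ∈ S, ∀ w ∉ S, τ v ≤ τ w) :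
    correlation G N q (fun v => if v ∈ S then τ v else τ v + h) =
      Complex.exp (-(h * freq G N q S)) * correlation G N q τ := by
  have h1 : ∑ e, q e * |(if G.tgt e ∈ S then τ (G.tgt e) else τ (G.tgt e) + h) -
      (if G.src e ∈ S then τ (G.src e) else τ (G.src e) + h)| =
      h * cutSum G S q + ∑ e, q e * |τ (G.tgt e) - τ (G.src e)| := by
    rw [cutSum_eq, Finset.mul_sum, ← Finset.sum_add_distrib]
    refine Finset.sum_congr rfl fun e _ => ?_
    by_cases a : G.src e ∈ S <;> by_cases b : G.tgt e ∈ S <;> simp only [a, b, if_true, if_false,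
      iff_true, iff_false, not_true]
    · ring
    · have := hτ _ a _ b
      rw [abs_of_nonneg (by linarith), abs_of_nonneg (by linarith)]
      ring
    · have := hτ _ b _ a
      rw [abs_of_nonpos (by linarith), abs_of_nonpos (by linarith)]
      ring
    · rw [add_sub_add_right_eq_sub]; ring
  have hN' : (∑ v, (N v : ℂ)) = 0 := by exact_mod_cast hN
  have h2 : ∑ v, (N v : ℂ) * ((if v ∈ S then τ v else τ v + h : ℝ) : ℂ) =
      ∑ v, (N v : ℂ) * τ v - h * ∑ v ∈ S, (N v : ℂ) := by
    have h3 : ∑ v ∈ S, (N v : ℂ) = ∑ v, if v ∈ S then (N v : ℂ) else 0 := by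
      rw [Finset.sum_ite_mem, Finset.univ_inter]
    have h4 : ∑ v, (N v : ℂ) * h = 0 := by rw [← Finset.sum_mul, hN', zero_mul]
    have h5 : ∑ v, (N v : ℂ) * τ v = ∑ v, ((N v : ℂ) * τ v + (N v : ℂ) * h) := by
      rw [Finset.sum_add_distrib, h4, add_zero]
    rw [h3, h5, Finset.mul_sum, ← Finset.sum_sub_distrib]
    refine Finset.sum_congr rfl fun v _ => ?_
    split_ifs <;> push_cast <;> ring
  rw [correlation, correlation, h1, h2, ← Complex.exp_add, freq]
  congr 1
  push_cast
  ring

theorem integral_correlation_singleton (G : MatsubaraGraph V E) {N : V → ℤ} (hN : ∑ v, N v = 0)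
    (q : E → ℝ) (v₀ : V) {t : ℝ} (ht : 0 ≤ t) :
    ∫ τ, correlation G N q τ ∂Measure.pi (vertexTime v₀ {v₀} t) =
      Complex.exp (-(t * freq G N q {v₀})) := by
  have h : vertexTime v₀ {v₀} t =
      fun v => Measure.dirac (if v ∈ ({v₀} : Finset V) then (0 : ℝ) else 0 + t) := by
    funext v
    by_cases hv : v = v₀ <;> simp [vertexTime, hv]
  rw [h, pi_dirac, integral_dirac,
    correlation_shift G hN q {v₀} ht (τ := fun _ => 0) (fun _ _ _ _ => le_rfl)]
  simp [correlation]

/-- The contribution of the time orders in which `v` is the last vertex of `S`. -/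
theorem integral_correlation_last (G : MatsubaraGraph V E) {N : V → ℤ} (hN : ∑ v, N v = 0)
    (q : E → ℝ) {v₀ v : V} {S : Finset V} (hv₀ : v₀ ∈ S) (hv : v ∈ S.erase v₀) {t : ℝ}
    (ht : 0 ≤ t) :
    ∫ τ, (if ∀ w ∈ S.erase v₀, τ w ≤ τ v then correlation G N q τ else 0)
        ∂Measure.pi (vertexTime v₀ S t) =
      ∫ s in (0 : ℝ)..t, Complex.exp (-((t - s : ℝ) * freq G N q S)) *
        ∫ τ, correlation G N q τ ∂Measure.pi (vertexTime v₀ (S.erase v) s) := by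
  have hne : v ≠ v₀ := Finset.ne_of_mem_erase hv
  have hvS : v ∈ S := Finset.mem_of_mem_erase hv
  have hbox : ∀ s : ℝ, {τ : V → ℝ | ∀ w ∈ S.erase v₀, τ w ≤ s} =
      Set.pi Set.univ fun w => if w ∈ S.erase v₀ then Set.Iic s else Set.univ := by
    intro s
    ext τ
    simp only [Set.mem_ofPred_eq, Set.mem_pi, Set.mem_univ, true_imp_iff]
    refine forall_congr' fun w => ?_
    by_cases hw : w ∈ S.erase v₀
    · rw [if_pos hw]; simp [hw]
    · rw [if_neg hw]; simp [hw]
  have hmeas : ∀ s : ℝ, MeasurableSet {τ : V → ℝ | ∀ w ∈ S.erase v₀, τ w ≤ s} := by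
    intro s
    rw [hbox]
    refine MeasurableSet.univ_pi fun w => ?_
    split_ifs
    · exact measurableSet_Iic
    · exact MeasurableSet.univ
  have hmeas' : MeasurableSet {τ : V → ℝ | ∀ w ∈ S.erase v₀, τ w ≤ τ v} := by
    simp only [Set.ofPred_forall]
    exact MeasurableSet.iInter fun w => MeasurableSet.iInter fun _ =>
      measurableSet_le (measurable_pi_apply w) (measurable_pi_apply v)
  have hvt : vertexTime v₀ S t v = volume.restrict (Set.Ioc 0 t) := by
    rw [vertexTime, if_neg hne, if_pos hvS]
  rw [integral_pi_eq_integral_integral (vertexTime v₀ S t) v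
    (f := fun s τ => if ∀ w ∈ S.erase v₀, τ w ≤ s then correlation G N q τ else 0)
    (fun s => (continuous_correlation G N q).measurable.ite (hmeas s) measurable_const)
    (by
      rw [ite_eq_indicator (fun τ : V → ℝ => ∀ w ∈ S.erase v₀, τ w ≤ τ v)]
      exact (integrable_correlation G N q v₀ S ht).indicator hmeas'),
    hvt, intervalIntegral.integral_of_le ht]
  refine setIntegral_congr_fun measurableSet_Ioc fun s hs => ?_
  -- With v last at time s, the other vertices of S except v₀ range over (0, s] and those outside S
  -- sit at t. This is the configuration of `S.erase v` at time s, with the vertices outside S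
  -- delayed by t - s; the delay costs the factor e^{-(t-s)ω_S}.
  have hfam : (fun w => (Function.update (vertexTime v₀ S t) v (Measure.dirac s) w).restrict
      (if w ∈ S.erase v₀ then Set.Iic s else Set.univ)) =
      fun w => (vertexTime v₀ (S.erase v) s w).map
        (fun x => if w ∈ S then x else x + (t - s)) := by
    funext w
    by_cases h0 : w = v₀
    · subst h0
      simp [Ne.symm hne, vertexTime, hv₀]
    by_cases h1 : w = v
    · subst h1
      have hr : (Measure.dirac s).restrict (Set.Iic s) = Measure.dirac s :=
        Measure.restrict_eq_self_of_ae_mem (by rw [ae_dirac_eq, eventually_pure]; exact Set.self_mem_Iic)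
      simp [hne, vertexTime, hvS, hr]
    by_cases h2 : w ∈ S
    · simp [h0, h1, h2, vertexTime, Measure.restrict_restrict, Set.Iic_inter_Ioc_of_le hs.2]
    · simp [h0, h1, h2, vertexTime, Measure.map_dirac]
  have hσ := sigmaFinite_update (vertexTime v₀ S t) v (Measure.dirac s)
  have hm : ∀ w : V, Measurable fun x : ℝ => if w ∈ S then x else x + (t - s) := by
    intro w
    split_ifs <;> fun_prop
  have hfin : ∀ w, IsFiniteMeasure ((vertexTime v₀ (S.erase v) s w).map
        (fun x => if w ∈ S then x else x + (t - s))) := fun w => inferInstance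
  rw [ite_eq_indicator (fun τ : V → ℝ => ∀ w ∈ S.erase v₀, τ w ≤ s), integral_indicator (hmeas s), hbox, Measure.restrict_pi_pi, hfam,
    ← Measure.pi_map_pi (fun w => (hm w).aemeasurable),
    integral_map (measurable_pi_lambda _ fun w =>
        show Measurable fun τ : V → ℝ => if w ∈ S then τ w else τ w + (t - s) from
          (hm w).comp (measurable_pi_apply w)).aemeasurable
      (continuous_correlation G N q).aestronglyMeasurable, ← integral_const_mul]
  refine integral_congr_ae ?_
  have hlast : ∀ w, ∀ᵐ x ∂vertexTime v₀ (S.erase v) s w, w ∉ S → x = s := by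
    intro w
    by_cases hw : w ∈ S
    · exact Eventually.of_forall fun x h => absurd hw h
    · have h0 : w ≠ v₀ := fun h => hw (h ▸ hv₀)
      rw [vertexTime, if_neg h0, if_neg (fun h => hw (Finset.mem_of_mem_erase h)),
        ae_dirac_eq, eventually_pure]
      exact fun _ => rfl
  filter_upwards [ae_pi_of_forall_ae fun w => ae_vertexTime_mem_Icc v₀ (S.erase v) hs.1.le w,
    ae_pi_of_forall_ae hlast] with τ h1 h2
  exact correlation_shift G hN q S (sub_nonneg.2 hs.2)
    (fun a _ b hb => by rw [h2 b hb]; exact (h1 a).2)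

/-- Ties are null, so almost surely exactly one vertex of `S.erase v₀` is latest. This is the
decomposition on which the induction in `integral_correlation` runs. -/
theorem ae_correlation_eq_sum (G : MatsubaraGraph V E) (N : V → ℤ) (q : E → ℝ) {v₀ : V}
    {S : Finset V} (hS : (S.erase v₀).Nonempty) (t : ℝ) :
    ∀ᵐ τ ∂Measure.pi (vertexTime v₀ S t), correlation G N q τ =
      ∑ v ∈ S.erase v₀, if ∀ w ∈ S.erase v₀, τ w ≤ τ v then correlation G N q τ else 0 := by
  have h : ∀ᵐ τ ∂Measure.pi (vertexTime v₀ S t), ∀ v w, w ∈ S.erase v₀ → v ≠ w → τ v ≠ τ w := by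
    refine ae_all_iff.2 fun v => ae_all_iff.2 fun w => ?_
    by_cases hw : w ∈ S.erase v₀
    · by_cases hvw : v = w
      · exact Eventually.of_forall fun _ _ h => absurd hvw h
      · have : NullSingletonClass (vertexTime v₀ S t w) := by
          rw [vertexTime, if_neg (Finset.ne_of_mem_erase hw), if_pos (Finset.mem_of_mem_erase hw)]
          infer_instance
        filter_upwards [ae_pi_ne (μ := vertexTime v₀ S t) hvw] with τ hτ _ _ using hτ
    · exact Eventually.of_forall fun _ h => absurd h hw
  filter_upwards [h] with τ hτ
  obtain ⟨v, hv, hmax⟩ := Finset.exists_max_image (S.erase v₀) τ hS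
  rw [Finset.sum_eq_single_of_mem v hv, if_pos hmax]
  intro w hw hwv
  rw [if_neg]
  exact fun h' => hτ w v hv hwv (le_antisymm (hmax w hw) (h' v hv))

theorem integral_exp_mul_exp {a b : ℂ} (hab : a ≠ b) (t : ℝ) :
    ∫ s in (0 : ℝ)..t, Complex.exp (-((t - s : ℝ) * a)) * Complex.exp (-(s * b)) =
      (Complex.exp (-(t * b)) - Complex.exp (-(t * a))) / (a - b) := by
  have h : ∀ s : ℝ, Complex.exp (-((t - s : ℝ) * a)) * Complex.exp (-(s * b)) =
      Complex.exp (-(t * a)) * Complex.exp ((a - b) * s) := by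
    intro s
    rw [← Complex.exp_add, ← Complex.exp_add]
    congr 1
    push_cast
    ring
  simp_rw [h]
  rw [intervalIntegral.integral_const_mul, integral_exp_mul_complex (sub_ne_zero.2 hab),
    mul_div_assoc', mul_sub, ← Complex.exp_add, ← Complex.exp_add]
  congr 3
  · ring
  · simp

/-- The evaluation of the time integral. -/
theorem integral_correlation (G : MatsubaraGraph V E) {N : V → ℤ} (hN : ∑ v, N v = 0)
    (q : E → ℝ) {v₀ : V}
    (hω : ∀ T T', v₀ ∈ T → T ⊂ T' → freq G N q T' ≠ freq G N q T) (S : Finset V) (hv₀ : v₀ ∈ S)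
    (t : ℝ) (ht : 0 ≤ t) :
    ∫ τ, correlation G N q τ ∂Measure.pi (vertexTime v₀ S t) =
      ∑ K ∈ Finset.Icc {v₀} S, Complex.exp (-(t * freq G N q K)) *
        (cochainSum (freq G N q) K {v₀} * chainSum (freq G N q) K S) := by
  induction hn : S.card using Nat.strong_induction_on generalizing S t with
  | _ n ih =>
    subst hn
    by_cases hS : S = {v₀}
    · subst hS
      rw [integral_correlation_singleton G hN q v₀ ht]
      simp [chainSum_self, cochainSum_self]
    have hsub : {v₀} ⊂ S :=
      (Finset.singleton_subset_iff.2 hv₀).ssubset_of_ne (Ne.symm hS)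
    have hne : (S.erase v₀).Nonempty := by
      rw [Finset.nonempty_iff_ne_empty, Ne, Finset.erase_eq_empty_iff]
      rintro (h | h)
      · simp [h] at hv₀
      · exact hS h
    have hmeas : ∀ v, MeasurableSet {τ : V → ℝ | ∀ w ∈ S.erase v₀, τ w ≤ τ v} := by
      intro v
      simp only [Set.ofPred_forall]
      exact MeasurableSet.iInter fun w => MeasurableSet.iInter fun _ =>
        measurableSet_le (measurable_pi_apply w) (measurable_pi_apply v)
    rw [integral_congr_ae (ae_correlation_eq_sum G N q hne t), integral_finsetSum _ fun v _ => by
        rw [ite_eq_indicator (fun τ : V → ℝ => ∀ w ∈ S.erase v₀, τ w ≤ τ v)]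
        exact (integrable_correlation G N q v₀ S ht).indicator (hmeas v)]
    -- The induction hypothesis for `S.erase v` at time s is a combination of e^{-sω_K}; convolving
    -- it with e^{-(t-s)ω_S} gives the difference quotients.
    have hstep : ∀ v ∈ S.erase v₀,
        ∫ τ, (if ∀ w ∈ S.erase v₀, τ w ≤ τ v then correlation G N q τ else 0)
          ∂Measure.pi (vertexTime v₀ S t) =
        ∑ K ∈ Finset.Icc {v₀} (S.erase v),
          (Complex.exp (-(t * freq G N q K)) - Complex.exp (-(t * freq G N q S))) /
            (freq G N q S - freq G N q K) *
          (cochainSum (freq G N q) K {v₀} * chainSum (freq G N q) K (S.erase v)) := by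
      intro v hv
      have hvS := Finset.mem_of_mem_erase hv
      have hv₀' : v₀ ∈ S.erase v := Finset.mem_erase.2 ⟨(Finset.ne_of_mem_erase hv).symm, hv₀⟩
      rw [integral_correlation_last G hN q hv₀ hv ht]
      have hcongr : ∀ s ∈ Set.uIcc 0 t, Complex.exp (-((t - s : ℝ) * freq G N q S)) *
          ∫ τ, correlation G N q τ ∂Measure.pi (vertexTime v₀ (S.erase v) s) =
          ∑ K ∈ Finset.Icc {v₀} (S.erase v),
            Complex.exp (-((t - s : ℝ) * freq G N q S)) * Complex.exp (-(s * freq G N q K)) *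
            (cochainSum (freq G N q) K {v₀} * chainSum (freq G N q) K (S.erase v)) := by
        intro s hs
        rw [Set.uIcc_of_le ht] at hs
        rw [ih _ (Finset.card_erase_lt_of_mem hvS) _ hv₀' s hs.1 rfl, Finset.mul_sum]
        exact Finset.sum_congr rfl fun K _ => (mul_assoc _ _ _).symm
      rw [intervalIntegral.integral_congr hcongr, intervalIntegral.integral_finsetSum]
      · refine Finset.sum_congr rfl fun K hK => ?_
        obtain ⟨h1, h2⟩ := Finset.mem_Icc.1 hK
        rw [intervalIntegral.integral_mul_const, integral_exp_mul_exp]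
        exact hω K S (Finset.singleton_subset_iff.1 h1)
          (lt_of_le_of_lt h2 (Finset.erase_ssubset hvS))
      · intro K _
        refine Continuous.intervalIntegrable ?_ _ _
        fun_prop
    rw [Finset.sum_congr rfl hstep,
      Finset.sum_comm' (t' := Finset.Icc {v₀} S) (s' := fun K => S \ K)]
    -- The terms e^{-tω_K} with K ≠ S already have the right coefficients by the recursion for
    -- `chainSum`. The coefficient of e^{-tω_S} comes out as minus the sum over K ≠ S; subtracting
    -- e^{-tω_S} times a vanishing sum identifies it with the missing term K = S.
    · have hzero := sum_cochainSum_mul_chainSum (ω := freq G N q) {v₀} S hsub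
        (fun T T' h1 h2 _ => hω T T' (Finset.singleton_subset_iff.1 h1) h2)
      rw [← sub_zero (∑ K ∈ Finset.Icc {v₀} S, Complex.exp (-(t * freq G N q K)) * _),
        ← mul_zero (Complex.exp (-(t * freq G N q S))), ← hzero, Finset.mul_sum,
        ← Finset.sum_sub_distrib]
      refine Finset.sum_congr rfl fun K hK => ?_
      obtain ⟨h1, h2⟩ := Finset.mem_Icc.1 hK
      rw [← Finset.mul_sum, ← Finset.mul_sum]
      by_cases hKS : K = S
      · subst hKS; simp
      · have hd := hω K S (Finset.singleton_subset_iff.1 h1) (h2.ssubset_of_ne hKS)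
        rw [← sub_mul_chainSum fun _ => hd]
        field_simp [sub_ne_zero.2 hd]
    · intro v K
      simp only [Finset.mem_sdiff, Finset.mem_Icc, Finset.subset_erase, Finset.mem_erase,
        Finset.singleton_subset_iff]
      constructor
      · rintro ⟨⟨a, b⟩, c, d, e⟩; exact ⟨⟨b, e⟩, c, d⟩
      · rintro ⟨⟨b, e⟩, c, d⟩; exact ⟨⟨fun h => e (h ▸ c), b⟩, c, d, e⟩

theorem integral_correlation_univ (G : MatsubaraGraph V E) {N : V → ℤ} (hN : ∑ v, N v = 0)
    (q : E → ℝ) {v₀ : V} (hω : ∀ T T', v₀ ∈ T → T ⊂ T' → freq G N q T' ≠ freq G N q T) :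
    ∫ τ, correlation G N q τ ∂Measure.pi (vertexTime v₀ Finset.univ 1) = periodSum G N v₀ q := by
  rw [integral_correlation G hN q hω _ (Finset.mem_univ _) 1 zero_le_one, periodSum]
  simp

end Correlation

/-! ### Sums over integer lattices as integrals -/

section Lattice

variable {ι : Type*} [Fintype ι]

/-- Lets sums over ℤ^ι of products factor by Fubini's theorem for product measures. -/
theorem pi_count : Measure.pi (fun _ : ι => (Measure.count : Measure ℤ)) = Measure.count := by
  refine Measure.ext_of_singleton fun n => ?_
  rw [Measure.pi_singleton]
  simp

theorem summable_norm_prod {f : ι → ℤ → ℂ} (hf : ∀ i, Summable fun n => ‖f i n‖) :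
    Summable fun n : ι → ℤ => ‖∏ i, f i (n i)‖ := by
  have h := Integrable.fintype_prod (μ := fun _ : ι => (Measure.count : Measure ℤ))
    fun i => integrable_count_iff.2 (hf i)
  rw [pi_count] at h
  exact integrable_count_iff.1 h

theorem integral_count_eq_tsum {α : Type*} [MeasurableSpace α] [MeasurableSingletonClass α]
    [Countable α] {E : Type*} [NormedAddCommGroup E] [NormedSpace ℝ E] [CompleteSpace E]
    {f : α → E} (hf : Summable fun n => ‖f n‖) : ∫ n, f n ∂Measure.count = ∑' n, f n := by
  rw [integral_countable (integrable_count_iff.2 hf)]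
  simp [measureReal_def]

theorem tsum_prod_eq_prod_tsum {f : ι → ℤ → ℂ} (hf : ∀ i, Summable fun n => ‖f i n‖) :
    ∑' n : ι → ℤ, ∏ i, f i (n i) = ∏ i, ∑' n, f i n := by
  have h := integral_fintype_prod_eq_prod (μ := fun _ : ι => (Measure.count : Measure ℤ)) f
  rw [pi_count, integral_count_eq_tsum (summable_norm_prod hf)] at h
  rw [h]
  exact Finset.prod_congr rfl fun i _ => integral_count_eq_tsum (hf i)

end Lattice

/-! ### The Fourier series of the propagator on the circle -/

section Propagator

theorem summable_propagator {q : ℝ} (hq : q ≠ 0) :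
    Summable fun n : ℤ => 1 / ((n : ℝ) ^ 2 + q ^ 2) := by
  refine Summable.of_norm_bounded_eventually
    (Real.summable_one_div_int_pow.2 one_lt_two) ?_
  filter_upwards [(Set.finite_singleton (0 : ℤ)).compl_mem_cofinite] with n hn
  have hn0 : (n : ℝ) ≠ 0 := by exact_mod_cast hn
  rw [Real.norm_of_nonneg (by positivity)]
  exact one_div_le_one_div_of_le (by positivity) (by nlinarith [sq_nonneg q])

theorem norm_propagator (q : ℝ) (n : ℤ) :
    ‖(1 / ((n : ℂ) ^ 2 + (q : ℂ) ^ 2) : ℂ)‖ = 1 / ((n : ℝ) ^ 2 + q ^ 2) := by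
  have : (1 / ((n : ℂ) ^ 2 + (q : ℂ) ^ 2) : ℂ) = ((1 / ((n : ℝ) ^ 2 + q ^ 2) : ℝ) : ℂ) := by
    push_cast; rfl
  rw [this, Complex.norm_real, Real.norm_of_nonneg (by positivity)]

/-- The propagator on the circle of length `1`. -/
def circlePropagator (q t : ℝ) : ℂ :=
  (1 + bose q : ℂ) * (Real.pi / q * Complex.exp (-(2 * Real.pi * q * t))) +
    bose q * (Real.pi / q * Complex.exp (2 * Real.pi * q * t))

theorem one_add_bose_mul_cexp {q : ℝ} (hq : q ≠ 0) :
    (1 + bose q : ℂ) * Complex.exp (-(2 * Real.pi * q)) = bose q := by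
  have h := congrArg (fun x : ℝ => (x : ℂ)) (one_add_bose_mul_exp hq)
  push_cast at h
  exact h

theorem bose_mul_cexp {q : ℝ} (hq : q ≠ 0) :
    (bose q : ℂ) * Complex.exp (2 * Real.pi * q) = 1 + bose q := by
  conv_lhs => rw [← one_add_bose_mul_cexp hq, mul_assoc, ← Complex.exp_add]
  simp

/-- The factors 1 + n and n are normalised so that the boundary terms at 0 and 1 become -1 and 1.
This leaves (1/2q) (1/(q + in) + 1/(q - in)). -/
theorem fourierCoeffOn_circlePropagator {q : ℝ} (hq : q ≠ 0) (n : ℤ) :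
    fourierCoeffOn zero_lt_one (circlePropagator q) n = 1 / ((n : ℂ) ^ 2 + (q : ℂ) ^ 2) := by
  have hπ : (Real.pi : ℂ) ≠ 0 := by exact_mod_cast Real.pi_ne_zero
  have hqc : (q : ℂ) ≠ 0 := by exact_mod_cast hq
  have h1 : (q + n * Complex.I : ℂ) ≠ 0 := fun h => hq (by simpa using congrArg Complex.re h)
  have h2 : (q - n * Complex.I : ℂ) ≠ 0 := fun h => hq (by simpa using congrArg Complex.re h)
  have c1 : (-(2 * Real.pi * (q + n * Complex.I)) : ℂ) ≠ 0 := by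
    simp [hπ, h1]
  have c2 : (2 * Real.pi * (q - n * Complex.I) : ℂ) ≠ 0 := by
    simp [hπ, h2]
  have hint : ∀ x : ℝ, fourier (-n) (x : AddCircle (1 - 0 : ℝ)) • circlePropagator q x =
      (1 + bose q : ℂ) * (Real.pi / q) * Complex.exp (-(2 * Real.pi * (q + n * Complex.I)) * x) +
      bose q * (Real.pi / q) * Complex.exp (2 * Real.pi * (q - n * Complex.I) * x) := by
    intro x
    have e1 : -(2 * Real.pi * (q + n * Complex.I)) * (x : ℂ) =
        2 * Real.pi * Complex.I * (-n : ℤ) * x / (1 - 0 : ℝ) + -(2 * Real.pi * q * x) := by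
      push_cast; ring
    have e2 : 2 * Real.pi * (q - n * Complex.I) * (x : ℂ) =
        2 * Real.pi * Complex.I * (-n : ℤ) * x / (1 - 0 : ℝ) + 2 * Real.pi * q * x := by
      push_cast; ring
    rw [fourier_coe_apply, circlePropagator, smul_eq_mul, e1, e2, Complex.exp_add,
      Complex.exp_add]
    ring
  have p1 : Complex.exp (-(2 * Real.pi * (q + n * Complex.I)) * (1 : ℝ)) =
      Complex.exp (-(2 * Real.pi * q)) := by
    rw [show -(2 * Real.pi * (q + n * Complex.I)) * ((1 : ℝ) : ℂ) =
      -(2 * Real.pi * q) + (-n : ℤ) * (2 * Real.pi * Complex.I) by push_cast; ring,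
      Complex.exp_add, Complex.exp_int_mul_two_pi_mul_I, mul_one]
  have p2 : Complex.exp (2 * Real.pi * (q - n * Complex.I) * (1 : ℝ)) =
      Complex.exp (2 * Real.pi * q) := by
    rw [show 2 * Real.pi * (q - n * Complex.I) * ((1 : ℝ) : ℂ) =
      2 * Real.pi * q + (-n : ℤ) * (2 * Real.pi * Complex.I) by push_cast; ring,
      Complex.exp_add, Complex.exp_int_mul_two_pi_mul_I, mul_one]
  rw [fourierCoeffOn_eq_integral]
  simp_rw [hint]
  rw [intervalIntegral.integral_add (Continuous.intervalIntegrable (by fun_prop) _ _)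
    (Continuous.intervalIntegrable (by fun_prop) _ _), intervalIntegral.integral_const_mul,
    intervalIntegral.integral_const_mul, integral_exp_mul_complex c1, integral_exp_mul_complex c2,
    p1, p2]
  have b1 : (1 + bose q : ℂ) * (Complex.exp (-(2 * Real.pi * q)) - 1) = -1 := by
    rw [mul_sub, one_add_bose_mul_cexp hq]; ring
  have b2 : (bose q : ℂ) * (Complex.exp (2 * Real.pi * q) - 1) = 1 := by
    rw [mul_sub, bose_mul_cexp hq]; ring
  have hd : (n : ℂ) ^ 2 + (q : ℂ) ^ 2 = (q + n * Complex.I) * (q - n * Complex.I) := by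
    linear_combination (n : ℂ) ^ 2 * Complex.I_sq
  simp only [Complex.ofReal_zero, mul_zero, Complex.exp_zero, sub_zero, div_one, one_smul]
  calc _ = (Real.pi / q) * ((1 + bose q : ℂ) * (Complex.exp (-(2 * Real.pi * q)) - 1)) /
          (-(2 * Real.pi * (q + n * Complex.I))) +
        (Real.pi / q) * ((bose q : ℂ) * (Complex.exp (2 * Real.pi * q) - 1)) /
          (2 * Real.pi * (q - n * Complex.I)) := by ring
    _ = _ := by
      rw [b1, b2, hd]
      field_simp
      ring

/-- The values at 0 and 1 agree, so the function is continuous on the circle, and its Fourier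
coefficients are summable; hence the series converges to it pointwise. The endpoint 1 follows by
periodicity, negative t by n ↦ -n. -/
theorem hasSum_circlePropagator {q : ℝ} (hq : q ≠ 0) {t : ℝ} (ht : |t| ≤ 1) :
    HasSum (fun n : ℤ => 1 / ((n : ℂ) ^ 2 + (q : ℂ) ^ 2) *
      Complex.exp (2 * Real.pi * Complex.I * n * t)) (circlePropagator q |t|) := by
  have hends : circlePropagator q 0 = circlePropagator q (0 + 1) := by
    have b1 := one_add_bose_mul_cexp hq
    have b2 := bose_mul_cexp hq
    simp only [circlePropagator, Complex.ofReal_zero, mul_zero, neg_zero, Complex.exp_zero,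
      zero_add, Complex.ofReal_one, mul_one]
    linear_combination -(Real.pi / q : ℂ) * b1 - (Real.pi / q : ℂ) * b2
  have hcont : Continuous (circlePropagator q) := by
    unfold circlePropagator
    fun_prop
  have hT : Fact ((0 : ℝ) < 1) := ⟨zero_lt_one⟩
  have key : ∀ y ∈ Set.Ico (0 : ℝ) 1, HasSum (fun n : ℤ => 1 / ((n : ℂ) ^ 2 + (q : ℂ) ^ 2) *
      Complex.exp (2 * Real.pi * Complex.I * n * y)) (circlePropagator q y) := by
    intro y hy
    let B : C(AddCircle (1 : ℝ), ℂ) := ⟨AddCircle.liftIco 1 0 (circlePropagator q),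
      AddCircle.liftIco_continuous hends hcont.continuousOn⟩
    have hcoeff : ∀ n, fourierCoeff B n = 1 / ((n : ℂ) ^ 2 + (q : ℂ) ^ 2) := by
      intro n
      have h := fourierCoeff_liftIco_eq (T := 1) (a := 0) (circlePropagator q) n
      rw [show fourierCoeff B n = fourierCoeff (AddCircle.liftIco 1 0 (circlePropagator q)) n
        from rfl, h]
      simpa only [zero_add] using! fourierCoeffOn_circlePropagator hq n
    have hsum : Summable (fourierCoeff B) := by
      refine Summable.of_norm ?_
      simp_rw [hcoeff, norm_propagator]
      exact summable_propagator hq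
    have h := has_pointwise_sum_fourier_series_of_summable hsum (y : AddCircle (1 : ℝ))
    have hB : B (y : AddCircle (1 : ℝ)) = circlePropagator q y :=
      AddCircle.liftIco_coe_apply (f := circlePropagator q) (show y ∈ Set.Ico 0 (0 + 1) by rwa [zero_add])
    rw [hB] at h
    simp_rw [hcoeff, fourier_coe_apply] at h
    simpa using h
  have key' : ∀ y ∈ Set.Icc (0 : ℝ) 1, HasSum (fun n : ℤ => 1 / ((n : ℂ) ^ 2 + (q : ℂ) ^ 2) *
      Complex.exp (2 * Real.pi * Complex.I * n * y)) (circlePropagator q y) := by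
    intro y hy
    rcases hy.2.lt_or_eq with h | h
    · exact key y ⟨hy.1, h⟩
    · have h0 := key 0 ⟨le_rfl, zero_lt_one⟩
      rw [h]
      rw [hends, zero_add] at h0
      convert h0 using 3 with n
      rw [show 2 * Real.pi * Complex.I * (n : ℂ) * ((1 : ℝ) : ℂ) =
        n * (2 * Real.pi * Complex.I) by push_cast; ring, Complex.exp_int_mul_two_pi_mul_I]
      simp
  rcases le_total 0 t with h | h
  · rw [abs_of_nonneg h] at ht ⊢
    exact key' t ⟨h, ht⟩
  · rw [abs_of_nonpos h] at ht ⊢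
    have h1 := key' (-t) ⟨by linarith, ht⟩
    rw [← (Equiv.neg ℤ).hasSum_iff] at h1
    convert h1 using 2 with n
    simp

end Propagator

/-! ### The Matsubara sum as an integral over vertex times -/

section MatsubaraSum

variable {V E : Type*} [Fintype V] [DecidableEq V] [Fintype E] [DecidableEq E]

theorem summable_propagators {q : E → ℝ} (hq : ∀ e, q e ≠ 0) :
    Summable fun n : E → ℤ => propagators q fun e => (n e : ℝ) := by
  have h := summable_norm_prod (f := fun e n => (1 / ((n : ℂ) ^ 2 + (q e : ℂ) ^ 2) : ℂ)) fun e => by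
    simp_rw [norm_propagator]; exact summable_propagator (hq e)
  refine h.congr fun n => ?_
  rw [norm_prod]
  exact Finset.prod_congr rfl fun e _ => norm_propagator _ _

theorem propagators_nonneg (q x : E → ℝ) : 0 ≤ propagators q x :=
  Finset.prod_nonneg fun e _ => by positivity

theorem kroneckerDelta_eq (G : MatsubaraGraph V E) (N : V → ℤ) (n : E → ℤ) :
    kroneckerDelta G N n = if ∀ v, flow G n v = N v then 1 else 0 := by
  unfold kroneckerDelta
  split_ifs with h
  · exact Finset.prod_eq_one fun v _ => if_pos (h v)
  · push Not at h
    obtain ⟨v, hv⟩ := h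
    exact Finset.prod_eq_zero (Finset.mem_univ v) (if_neg hv)

theorem summand_nonneg (G : MatsubaraGraph V E) (N : V → ℤ) (q : E → ℝ) (n : E → ℤ) :
    0 ≤ summand G N q n := by
  rw [summand, kroneckerDelta_eq]
  split_ifs <;> simp [propagators_nonneg]

theorem summand_le (G : MatsubaraGraph V E) (N : V → ℤ) (q : E → ℝ) (n : E → ℤ) :
    summand G N q n ≤ propagators q fun e => (n e : ℝ) := by
  rw [summand, kroneckerDelta_eq]
  split_ifs <;> simp [propagators_nonneg]

theorem summable_summand (G : MatsubaraGraph V E) (N : V → ℤ) {q : E → ℝ} (hq : ∀ e, q e ≠ 0) :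
    Summable (summand G N q) :=
  Summable.of_nonneg_of_le (summand_nonneg G N q) (summand_le G N q) (summable_propagators hq)

theorem sum_sign_mul {R : Type*} [CommRing R] (G : MatsubaraGraph V E) (e : E) (τ : V → R) :
    ∑ v, (sign G v e : R) * τ v = τ (G.tgt e) - τ (G.src e) := by
  have h : ∀ v, (sign G v e : R) * τ v =
      (if G.tgt e = v then τ v else 0) - (if G.src e = v then τ v else 0) := by
    intro v
    have := G.loopless e
    unfold sign
    by_cases h1 : G.tgt e = v
    · have h2 : G.src e ≠ v := fun h => this (h.trans h1.symm)
      simp [h1, h2]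
    · by_cases h2 : G.src e = v <;> simp [h1, h2]
  simp_rw [h]
  rw [Finset.sum_sub_distrib]
  simp

/-- Summation by parts on the graph: it moves phases between lines and vertices. -/
theorem sum_flow_mul {R : Type*} [CommRing R] (G : MatsubaraGraph V E) (n : E → R) (τ : V → R) :
    ∑ v, flow G n v * τ v = ∑ e, n e * (τ (G.tgt e) - τ (G.src e)) := by
  simp_rw [flow, Finset.sum_mul, ← sum_sign_mul G _ τ, Finset.mul_sum]
  rw [Finset.sum_comm]
  exact Finset.sum_congr rfl fun e _ => Finset.sum_congr rfl fun v _ => by ring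

theorem sum_flow {R : Type*} [CommRing R] (G : MatsubaraGraph V E) (n : E → R) :
    ∑ v, flow G n v = 0 := by
  simpa using sum_flow_mul G n fun _ => (1 : R)

/-- A balanced family of conditions holds at all vertices if it holds at all but one of them. -/
theorem flow_eq_of_forall_ne (G : MatsubaraGraph V E) {N : V → ℤ} (hN : ∑ v, N v = 0) (v₀ : V)
    (n : E → ℤ) (h : ∀ v, v ≠ v₀ → flow G n v = N v) (v : V) : flow G n v = N v := by
  by_cases hv : v = v₀
  · subst hv
    have h1 := (sum_flow G n).trans hN.symm
    rw [← Finset.add_sum_erase _ _ (Finset.mem_univ v),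
      ← Finset.add_sum_erase _ N (Finset.mem_univ v),
      Finset.sum_congr rfl fun w hw => h w (Finset.ne_of_mem_erase hw)] at h1
    exact add_right_cancel h1
  · exact h v hv

/-- The general term of the Fourier expansion of the product of circle propagators. -/
def fourierTerm (G : MatsubaraGraph V E) (N : V → ℤ) (q : E → ℝ) (n : E → ℤ) (τ : V → ℝ) : ℂ :=
  Complex.exp (-(2 * Real.pi * (Complex.I * ∑ v, (N v : ℂ) * τ v))) *
    ∏ e, (1 / ((n e : ℂ) ^ 2 + (q e : ℂ) ^ 2) *
      Complex.exp (2 * Real.pi * Complex.I * n e * (τ (G.tgt e) - τ (G.src e) : ℝ)))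

theorem fourierTerm_eq (G : MatsubaraGraph V E) (N : V → ℤ) (q : E → ℝ) (n : E → ℤ)
    (τ : V → ℝ) : fourierTerm G N q n τ = (propagators q fun e => (n e : ℝ) : ℝ) *
      ∏ v, Complex.exp (2 * Real.pi * Complex.I * (flow G n v - N v : ℤ) * τ v) := by
  have h := sum_flow_mul G (fun e => (n e : ℂ)) (fun v => (τ v : ℂ))
  have h' : ∀ v, flow G (fun e => (n e : ℂ)) v = ((flow G n v : ℤ) : ℂ) := by
    intro v; simp [flow]
  simp_rw [h'] at h
  rw [fourierTerm, Finset.prod_mul_distrib, ← Complex.exp_sum, ← Complex.exp_sum, propagators,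
    mul_left_comm, ← Complex.exp_add]
  congr 1
  · push_cast; rfl
  · congr 1
    have e1 : ∑ e, 2 * Real.pi * Complex.I * n e * ((τ (G.tgt e) - τ (G.src e) : ℝ) : ℂ) =
        2 * Real.pi * Complex.I * ∑ v, ((flow G n v : ℤ) : ℂ) * τ v := by
      rw [h, Finset.mul_sum]
      refine Finset.sum_congr rfl fun e _ => ?_
      push_cast; ring
    have e2 : ∑ v, 2 * Real.pi * Complex.I * ((flow G n v - N v : ℤ) : ℂ) * (τ v : ℂ) =
        2 * Real.pi * Complex.I * (∑ v, ((flow G n v : ℤ) : ℂ) * τ v - ∑ v, (N v : ℂ) * τ v) := by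
      rw [← Finset.sum_sub_distrib, Finset.mul_sum]
      refine Finset.sum_congr rfl fun v _ => ?_
      push_cast; ring
    rw [e1, e2]
    ring

theorem norm_fourierTerm (G : MatsubaraGraph V E) (N : V → ℤ) (q : E → ℝ) (n : E → ℤ)
    (τ : V → ℝ) : ‖fourierTerm G N q n τ‖ = propagators q fun e => (n e : ℝ) := by
  rw [fourierTerm_eq, norm_mul, Complex.norm_real, Real.norm_of_nonneg (propagators_nonneg _ _),
    norm_prod, Finset.prod_eq_one, mul_one]
  intro v _
  rw [show 2 * Real.pi * Complex.I * ((flow G n v - N v : ℤ) : ℂ) * (τ v : ℂ) =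
    ((2 * Real.pi * (flow G n v - N v : ℤ) * τ v : ℝ) : ℂ) * Complex.I by push_cast; ring,
    Complex.norm_exp_ofReal_mul_I]

theorem integral_exp_two_pi (k : ℤ) :
    ∫ x in Set.Ioc (0 : ℝ) 1, Complex.exp (2 * Real.pi * Complex.I * k * x) =
      if k = 0 then 1 else 0 := by
  rw [← intervalIntegral.integral_of_le zero_le_one]
  split_ifs with h
  · subst h; simp
  · have hc : (2 * Real.pi * Complex.I * k : ℂ) ≠ 0 :=
      mul_ne_zero Complex.two_pi_I_ne_zero (by exact_mod_cast h)
    rw [integral_exp_mul_complex hc, show 2 * Real.pi * Complex.I * (k : ℂ) * ((1 : ℝ) : ℂ) =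
      k * (2 * Real.pi * Complex.I) by push_cast; ring, Complex.exp_int_mul_two_pi_mul_I]
    simp

theorem integral_fourierTerm (G : MatsubaraGraph V E) {N : V → ℤ} (hN : ∑ v, N v = 0)
    (q : E → ℝ) (n : E → ℤ) (v₀ : V) :
    ∫ τ, fourierTerm G N q n τ ∂Measure.pi (vertexTime v₀ Finset.univ 1) = summand G N q n := by
  simp_rw [fourierTerm_eq]
  rw [integral_const_mul, integral_fintype_prod_eq_prod (μ := vertexTime v₀ Finset.univ 1)
    (f := fun v x => Complex.exp (2 * Real.pi * Complex.I * (flow G n v - N v : ℤ) * (x : ℝ)))]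
  -- At v₀ the point mass gives 1, so one Kronecker delta is absent from the product; it follows
  -- from the others because both sides sum to zero over the vertices.
  have h : ∀ v, ∫ x, Complex.exp (2 * Real.pi * Complex.I * (flow G n v - N v : ℤ) * (x : ℝ))
      ∂vertexTime v₀ Finset.univ 1 v = if v ≠ v₀ → flow G n v = N v then 1 else 0 := by
    intro v
    by_cases hv : v = v₀
    · simp [vertexTime, hv]
    · rw [vertexTime, if_neg hv, if_pos (Finset.mem_univ v), integral_exp_two_pi]
      simp [hv, sub_eq_zero]
  simp_rw [h]
  rw [summand, kroneckerDelta_eq, mul_comm]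
  by_cases hall : ∀ v, flow G n v = N v
  · simp [hall]
  · rw [if_neg hall]
    have hex : ∃ v, v ≠ v₀ ∧ flow G n v ≠ N v := by
      by_contra! hcon
      exact hall (flow_eq_of_forall_ne G hN v₀ n hcon)
    obtain ⟨v, hv, hv'⟩ := hex
    rw [Finset.prod_eq_zero (Finset.mem_univ v) (if_neg fun h => hv' (h hv))]
    simp

theorem tsum_fourierTerm (G : MatsubaraGraph V E) (N : V → ℤ) {q : E → ℝ} (hq : ∀ e, q e ≠ 0)
    {τ : V → ℝ} (hτ : ∀ v, τ v ∈ Set.Icc (0 : ℝ) 1) :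
    ∑' n, fourierTerm G N q n τ =
      Complex.exp (-(2 * Real.pi * (Complex.I * ∑ v, (N v : ℂ) * τ v))) *
        ∏ e, circlePropagator (q e) |τ (G.tgt e) - τ (G.src e)| := by
  have hd : ∀ e, |τ (G.tgt e) - τ (G.src e)| ≤ 1 := by
    intro e
    obtain ⟨a, b⟩ := hτ (G.tgt e)
    obtain ⟨c, d⟩ := hτ (G.src e)
    rw [abs_le]
    constructor <;> linarith
  have hs : ∀ e, Summable fun n : ℤ => ‖(1 / ((n : ℂ) ^ 2 + (q e : ℂ) ^ 2) *
      Complex.exp (2 * Real.pi * Complex.I * n * (τ (G.tgt e) - τ (G.src e) : ℝ)))‖ := by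
    intro e
    refine (summable_propagator (hq e)).congr fun n => ?_
    rw [norm_mul, norm_propagator,
      show 2 * Real.pi * Complex.I * (n : ℂ) * ((τ (G.tgt e) - τ (G.src e) : ℝ) : ℂ) =
      ((2 * Real.pi * n * (τ (G.tgt e) - τ (G.src e)) : ℝ) : ℂ) * Complex.I by push_cast; ring,
      Complex.norm_exp_ofReal_mul_I, mul_one]
  simp_rw [fourierTerm]
  rw [tsum_mul_left, tsum_prod_eq_prod_tsum hs]
  congr 1
  exact Finset.prod_congr rfl fun e _ => (hasSum_circlePropagator (hq e) (hd e)).tsum_eq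

/-- Each factor is 1 + n(1 - R) applied to (π/q) e^{-2πq|t|}. Expanding the product over the set A
of reflected lines produces the weights of the operator. -/
theorem exp_mul_prod_circlePropagator (G : MatsubaraGraph V E) (N : V → ℤ) (q : E → ℝ)
    (τ : V → ℝ) :
    Complex.exp (-(2 * Real.pi * (Complex.I * ∑ v, (N v : ℂ) * τ v))) *
        ∏ e, circlePropagator (q e) |τ (G.tgt e) - τ (G.src e)| =
      ∑ A : Finset E, (weight Finset.univ q A : ℂ) *
        ((∏ e, (Real.pi / flip A q e : ℂ)) * correlation G N (flip A q) τ) := by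
  have h : ∀ e, circlePropagator (q e) |τ (G.tgt e) - τ (G.src e)| =
      (-bose (q e) : ℂ) * (Real.pi / (-q e : ℝ) *
        Complex.exp (-(2 * Real.pi * ((-q e * |τ (G.tgt e) - τ (G.src e)| : ℝ) : ℂ)))) +
      (1 + bose (q e) : ℂ) * (Real.pi / q e *
        Complex.exp (-(2 * Real.pi * ((q e * |τ (G.tgt e) - τ (G.src e)| : ℝ) : ℂ)))) := by
    intro e
    rw [circlePropagator,
      show -(2 * Real.pi * ((-q e * |τ (G.tgt e) - τ (G.src e)| : ℝ) : ℂ)) =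
        2 * Real.pi * q e * |τ (G.tgt e) - τ (G.src e)| by push_cast; ring,
      show -(2 * Real.pi * ((q e * |τ (G.tgt e) - τ (G.src e)| : ℝ) : ℂ)) =
        -(2 * Real.pi * q e * |τ (G.tgt e) - τ (G.src e)|) by push_cast; ring,
      Complex.ofReal_neg, div_neg]
    ring
  simp_rw [h]
  rw [Finset.prod_add, Finset.powerset_univ, Finset.mul_sum]
  refine Finset.sum_congr rfl fun A _ => ?_
  have hA : (∏ e ∈ A, ((-bose (q e) : ℂ) * (Real.pi / (-q e : ℝ) *
        Complex.exp (-(2 * Real.pi * ((-q e * |τ (G.tgt e) - τ (G.src e)| : ℝ) : ℂ)))))) *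
      (∏ e ∈ Finset.univ \ A, ((1 + bose (q e) : ℂ) * (Real.pi / q e *
        Complex.exp (-(2 * Real.pi * ((q e * |τ (G.tgt e) - τ (G.src e)| : ℝ) : ℂ)))))) =
      ∏ e, (((if e ∈ A then -bose (q e) else 1 + bose (q e) : ℝ) : ℂ) * (Real.pi / flip A q e *
        Complex.exp (-(2 * Real.pi * ((flip A q e * |τ (G.tgt e) - τ (G.src e)| : ℝ) : ℂ))))) := by
    rw [← Finset.prod_sdiff (Finset.subset_univ A), mul_comm]
    congr 1
    · refine Finset.prod_congr rfl fun e he => ?_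
      have he' := (Finset.mem_sdiff.1 he).2
      simp only [flip, if_neg he']
      push_cast
      rfl
    · refine Finset.prod_congr rfl fun e he => ?_
      simp only [flip, if_pos he]
      push_cast
      rfl
  rw [hA, Finset.prod_mul_distrib, Finset.prod_mul_distrib, ← Complex.exp_sum, weight,
    Complex.ofReal_prod, mul_left_comm, mul_left_comm (Complex.exp _), ← Complex.exp_add,
    correlation]
  congr 3
  rw [Finset.sum_neg_distrib, ← Finset.mul_sum]
  push_cast
  ring

/-- The Matsubara sum as a combination of integrals over the times of the vertices. -/
theorem matsubaraSum_eq_sum_integral (G : MatsubaraGraph V E) {N : V → ℤ} (hN : ∑ v, N v = 0)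
    {q : E → ℝ} (hq : ∀ e, q e ≠ 0) (v₀ : V) :
    (matsubaraSum G N q : ℂ) = ∑ A : Finset E, (weight Finset.univ q A : ℂ) *
      ((∏ e, (Real.pi / flip A q e : ℂ)) *
        ∫ τ, correlation G N (flip A q) τ ∂Measure.pi (vertexTime v₀ Finset.univ 1)) := by
  have hprob : ∀ v, IsProbabilityMeasure (vertexTime v₀ Finset.univ 1 v) := by
    intro v
    unfold vertexTime
    split_ifs with h1 h2
    · infer_instance
    · exact ⟨by simp⟩
    · exact absurd (Finset.mem_univ v) h2
  have hcont : ∀ n, Continuous (fourierTerm G N q n) := by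
    intro n
    unfold fourierTerm
    fun_prop
  have h := hasSum_integral_of_summable_integral_norm
    (μ := Measure.pi (vertexTime v₀ Finset.univ 1)) (F := fourierTerm G N q)
    (fun n => Integrable.of_bound (hcont n).aestronglyMeasurable
      (propagators q fun e => (n e : ℝ))
      (Eventually.of_forall fun τ => (norm_fourierTerm G N q n τ).le))
    (by
      simp_rw [norm_fourierTerm]
      simpa using summable_propagators hq)
  simp_rw [integral_fourierTerm G hN q _ v₀] at h
  rw [matsubaraSum, Complex.ofReal_tsum, h.tsum_eq]
  have hae : (fun τ => ∑' n, fourierTerm G N q n τ)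
      =ᵐ[Measure.pi (vertexTime v₀ Finset.univ 1)] fun τ =>
      ∑ A : Finset E, (weight Finset.univ q A : ℂ) *
        ((∏ e, (Real.pi / flip A q e : ℂ)) * correlation G N (flip A q) τ) := by
    filter_upwards [ae_pi_of_forall_ae
      fun v => ae_vertexTime_mem_Icc v₀ Finset.univ zero_le_one v] with τ hτ
    rw [tsum_fourierTerm G N hq hτ, exp_mul_prod_circlePropagator]
  rw [integral_congr_ae hae, integral_finsetSum]
  · simp_rw [integral_const_mul]
  · intro A _
    exact ((integrable_correlation G N (flip A q) v₀ _ zero_le_one).const_mul _).const_mul _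

theorem matsubaraSum_eq_sum_timeOrdered (G : MatsubaraGraph V E) {N : V → ℤ}
    (hN : ∑ v, N v = 0) {q : E → ℝ} (hq : ∀ e, q e ≠ 0) (v₀ : V)
    (hω : ∀ A T T', v₀ ∈ T → T ⊂ T' → freq G N (flip A q) T' ≠ freq G N (flip A q) T) :
    (matsubaraSum G N q : ℂ) =
      ∑ A : Finset E, (weight Finset.univ q A : ℂ) * timeOrdered G N v₀ (flip A q) := by
  rw [matsubaraSum_eq_sum_integral G hN hq v₀, ← sum_weight_mul_periodSum G hN v₀ q hq]
  exact Finset.sum_congr rfl fun A _ => by rw [integral_correlation_univ G hN _ (hω A)]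

end MatsubaraSum

/-! ### Solving the constraints: existence, dimension, integrality -/

section Independent

variable {V E : Type*} [Fintype V] [DecidableEq V] [Fintype E] [DecidableEq E]

theorem eq_of_forall_line (G : MatsubaraGraph V E) {α : Type*} {f : V → α}
    (h : ∀ e, f (G.src e) = f (G.tgt e)) (u v : V) : f u = f v := by
  obtain ⟨w⟩ := G.connected.preconnected u v
  induction w with
  | nil => rfl
  | cons hadj _ ih =>
    rw [← ih]
    obtain ⟨-, ⟨e, rfl, rfl⟩ | ⟨e, rfl, rfl⟩⟩ := (SimpleGraph.fromRel_adj _ _ _).1 hadj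
    · exact h e
    · exact (h e).symm

theorem cut_nonempty (G : MatsubaraGraph V E) {K : Finset V} (h0 : K ≠ ∅)
    (h1 : K ≠ Finset.univ) : (cut G K).Nonempty := by
  by_contra hne
  rw [Finset.not_nonempty_iff_eq_empty] at hne
  have h : ∀ e, (G.src e ∈ K) = (G.tgt e ∈ K) := by
    intro e
    by_contra hcon
    have : e ∈ cut G K := by simpa [cut] using hcon
    rw [hne] at this
    simp at this
  obtain ⟨u, hu⟩ := Finset.nonempty_iff_ne_empty.2 h0
  refine h1 (Finset.eq_univ_iff_forall.2 fun v => ?_)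
  rwa [← eq_of_forall_line G (f := fun v => v ∈ K) h u v]

/-- The map `x ↦ (T_v(x))_v` as a linear map. -/
def flowMap (G : MatsubaraGraph V E) : (E → ℝ) →ₗ[ℝ] V → ℝ where
  toFun x := flow G x
  map_add' x y := by
    funext v
    simp [flow, mul_add, Finset.sum_add_distrib]
  map_smul' c x := by
    funext v
    simp only [flow, Pi.smul_apply, smul_eq_mul, RingHom.id_apply, Finset.mul_sum]
    exact Finset.sum_congr rfl fun e _ => by ring

theorem flowMap_apply (G : MatsubaraGraph V E) (x : E → ℝ) (v : V) :
    flowMap G x v = flow G x v := rfl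

/-- A functional that vanishes on the range takes equal values at the two ends of every line. By
connectedness it is then a multiple of the sum over the vertices. -/
theorem mem_range_flowMap (G : MatsubaraGraph V E) {z : V → ℝ} (hz : ∑ v, z v = 0) :
    z ∈ LinearMap.range (flowMap G) := by
  by_contra hcon
  obtain ⟨φ, hφz, hφ⟩ := Submodule.exists_le_ker_of_notMem hcon
  have hφ' : ∀ y, φ y = ∑ v, y v * φ (Pi.single v 1) := by
    intro y
    conv_lhs => rw [pi_eq_sum_univ' y]
    simp
  have hconst : ∀ e, φ (Pi.single (G.src e) 1) = φ (Pi.single (G.tgt e) 1) := by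
    intro e
    have h1 : φ (flowMap G (Pi.single e 1)) = 0 := hφ ⟨_, rfl⟩
    rw [hφ'] at h1
    simp_rw [flowMap_apply] at h1
    rw [sum_flow_mul] at h1
    simp only [Pi.single_apply, ite_mul, one_mul, zero_mul, Finset.sum_ite_eq',
      Finset.mem_univ, if_true] at h1
    linarith
  obtain ⟨v₀⟩ := G.connected.nonempty
  apply hφz
  rw [hφ']
  simp_rw [fun v => eq_of_forall_line G (f := fun v => φ (Pi.single v 1)) hconst v v₀]
  rw [← Finset.sum_mul, hz, zero_mul]

theorem exists_isIndependentSet (G : MatsubaraGraph V E) {N : V → ℤ} (hN : ∑ v, N v = 0) :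
    ∃ F : Finset E, IsIndependentSet G N F := by
  classical
  let w : E → V → ℝ := fun e => flowMap G (Pi.single e 1)
  have hw : ∀ x : E → ℝ, flowMap G x = ∑ e, x e • w e := by
    intro x
    conv_lhs => rw [pi_eq_sum_univ' x]
    rw [map_sum]
    refine Finset.sum_congr rfl fun e _ => ?_
    rw [map_smul]
  -- A maximal independent family of columns (a spanning tree) is solved for; the lines outside it
  -- are the free variables.
  obtain ⟨κ, a, ha, hspan, hli⟩ := exists_linearIndependent' ℝ w
  have : Finite κ := Finite.of_injective a ha
  have : Fintype κ := Fintype.ofFinite κ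
  refine ⟨Finset.univ.filter fun e => e ∉ Set.range a, fun y => ?_⟩
  let y' : E → ℝ := fun e => if h : e ∈ Finset.univ.filter fun e => e ∉ Set.range a then y ⟨e, h⟩
    else 0
  have hz : (fun v => (N v : ℝ)) - flowMap G y' ∈ LinearMap.range (flowMap G) := by
    refine mem_range_flowMap G ?_
    simp only [Pi.sub_apply, Finset.sum_sub_distrib, flowMap_apply, sum_flow, sub_zero]
    exact_mod_cast hN
  have hz' : (fun v => (N v : ℝ)) - flowMap G y' ∈ Submodule.span ℝ (Set.range (w ∘ a)) := by
    rw [hspan]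
    obtain ⟨x, hx⟩ := hz
    rw [← hx, hw]
    exact Submodule.sum_mem _ fun e _ =>
      Submodule.smul_mem _ _ (Submodule.subset_span ⟨e, rfl⟩)
  obtain ⟨c, hc⟩ := (Submodule.mem_span_range_iff_exists_fun ℝ).1 hz'
  have hy' : ∀ k, y' (a k) = 0 := fun k => dif_neg (by simp)
  let d : E → ℝ := ∑ k, c k • Pi.single (a k) 1
  have hd : flowMap G d = (fun v => (N v : ℝ)) - flowMap G y' := by
    rw [← hc, map_sum]
    exact Finset.sum_congr rfl fun k _ => by rw [map_smul]; rfl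
  have hdF : ∀ e, e ∉ Set.range a → d e = 0 := by
    intro e he
    simp only [d, Finset.sum_apply, Pi.smul_apply, smul_eq_mul]
    refine Finset.sum_eq_zero fun k _ => ?_
    rw [Pi.single_eq_of_ne (fun h => he ⟨k, h.symm⟩), mul_zero]
  refine ⟨d + y', ⟨fun v => ?_, fun l => ?_⟩, ?_⟩
  · have := congrFun (show flowMap G (d + y') = fun v => (N v : ℝ) by
      rw [map_add, hd, sub_add_cancel]) v
    exact this
  · have hl := l.2
    rw [Pi.add_apply, hdF l (by simpa using hl), zero_add]
    exact dif_pos hl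
  · rintro x ⟨hx1, hx2⟩
    have hdiff : flowMap G (x - (d + y')) = 0 := by
      rw [map_sub, map_add, hd, sub_add_cancel, sub_eq_zero]
      funext v
      exact hx1 v
    have hzero : ∀ e, e ∉ Set.range a → (x - (d + y')) e = 0 := by
      intro e he
      have hmem : e ∈ Finset.univ.filter fun e => e ∉ Set.range a := by simpa using he
      have h1 := hx2 ⟨e, hmem⟩
      simp only at h1
      rw [Pi.sub_apply, Pi.add_apply, hdF e he, zero_add, h1, sub_eq_zero]
      simp only [y', dif_pos hmem]
    have hsum : ∑ k, (x - (d + y')) (a k) • (w ∘ a) k = 0 := by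
      rw [hw, ← Finset.sum_subset (Finset.subset_univ (Finset.univ.image a))] at hdiff
      · rwa [Finset.sum_image fun _ _ _ _ h => ha h] at hdiff
      · intro e _ he
        rw [hzero e (by simpa using he), zero_smul]
    have hcoef := Fintype.linearIndependent_iff.1 hli _ hsum
    refine sub_eq_zero.1 (funext fun e => ?_)
    by_cases he : e ∈ Set.range a
    · obtain ⟨k, rfl⟩ := he
      exact hcoef k
    · exact hzero e he

variable {G : MatsubaraGraph V E} {N : V → ℤ} {F : Finset E}

theorem IsIndependentSet.flow_solution (hF : IsIndependentSet G N F) (y : F → ℝ) (v : V) :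
    flow G (hF.solution y) v = N v :=
  (hF y).choose_spec.1.1 v

theorem IsIndependentSet.solution_apply (hF : IsIndependentSet G N F) (y : F → ℝ) (l : F) :
    hF.solution y l = y l :=
  (hF y).choose_spec.1.2 l

theorem IsIndependentSet.eq_solution (hF : IsIndependentSet G N F) {y : F → ℝ} {x : E → ℝ}
    (h1 : ∀ v, flow G x v = N v) (h2 : ∀ l : F, x l = y l) : x = hF.solution y :=
  (hF y).choose_spec.2 x ⟨h1, h2⟩

theorem IsIndependentSet.eq_zero (hF : IsIndependentSet G N F) {d : E → ℝ}
    (h1 : flowMap G d = 0) (h2 : ∀ l : F, d l = 0) : d = 0 := by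
  have h : hF.solution 0 + d = hF.solution 0 := by
    refine hF.eq_solution (fun v => ?_) fun l => ?_
    · rw [← flowMap_apply, map_add, h1, add_zero]
      exact hF.flow_solution 0 v
    · rw [Pi.add_apply, h2 l, add_zero, hF.solution_apply]
  simpa using h

/-- The linear part of the solution of the constraints. -/
def IsIndependentSet.linearPart (hF : IsIndependentSet G N F) : (F → ℝ) →ₗ[ℝ] E → ℝ where
  toFun y := hF.solution y - hF.solution 0
  map_add' y z := by
    have h : hF.solution y + hF.solution z - hF.solution 0 = hF.solution (y + z) := by
      refine hF.eq_solution (fun v => ?_) fun l => ?_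
      · rw [← flowMap_apply, map_sub, map_add]
        simp only [Pi.sub_apply, Pi.add_apply, flowMap_apply, hF.flow_solution]
        ring
      · simp only [Pi.sub_apply, Pi.add_apply, hF.solution_apply, Pi.zero_apply, sub_zero]
    rw [← h]
    abel
  map_smul' c y := by
    have h : c • hF.solution y + (1 - c) • hF.solution 0 = hF.solution (c • y) := by
      refine hF.eq_solution (fun v => ?_) fun l => ?_
      · rw [← flowMap_apply, map_add, map_smul, map_smul]
        simp only [Pi.add_apply, Pi.smul_apply, smul_eq_mul, flowMap_apply, hF.flow_solution]
        ring
      · simp only [Pi.add_apply, Pi.smul_apply, smul_eq_mul, hF.solution_apply, Pi.zero_apply,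
          mul_zero, add_zero]
    rw [← h, RingHom.id_apply, smul_sub, sub_smul, one_smul]
    abel

theorem IsIndependentSet.continuous_solution (hF : IsIndependentSet G N F) :
    Continuous hF.solution := by
  have h : hF.solution = fun y => hF.linearPart y + hF.solution 0 := by
    funext y
    exact (sub_add_cancel _ _).symm
  rw [h]
  exact hF.linearPart.continuous_of_finiteDimensional.add continuous_const

/-- F has as many elements as the graph has independent loops. Flows miss exactly one dimension,
that of the sum over the vertices; the extra variable c along the constant vector fills it and makes
Φ bijective. -/
theorem IsIndependentSet.card_add_card (hF : IsIndependentSet G N F) :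
    F.card + Fintype.card V = Fintype.card E + 1 := by
  obtain ⟨v₀⟩ := G.connected.nonempty
  have hV : (Fintype.card V : ℝ) ≠ 0 := by
    exact_mod_cast (Fintype.card_pos_iff.2 ⟨v₀⟩).ne'
  let Φ : (E → ℝ) × ℝ →ₗ[ℝ] (F → ℝ) × (V → ℝ) :=
    LinearMap.prod
      ((LinearMap.funLeft ℝ ℝ (fun l : F => (l : E))).comp (LinearMap.fst ℝ _ _))
      ((flowMap G).comp (LinearMap.fst ℝ _ _) +
        (LinearMap.toSpanSingleton ℝ (V → ℝ) 1).comp (LinearMap.snd ℝ _ _))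
  have hΦ : ∀ x c, Φ (x, c) = (fun l : F => x l, flowMap G x + c • 1) := fun x c => rfl
  have hsum : ∀ x c, ∑ v, (flowMap G x + c • (1 : V → ℝ)) v = c * Fintype.card V := by
    intro x c
    simp [Finset.sum_add_distrib, flowMap_apply, sum_flow, mul_comm]
  have hbij : Function.Bijective Φ := by
    constructor
    · rw [← LinearMap.ker_eq_bot, LinearMap.ker_eq_bot']
      rintro ⟨x, c⟩ h
      rw [hΦ] at h
      obtain ⟨h1, h2⟩ := Prod.mk.inj h
      have h3 := hsum x c
      rw [h2] at h3
      have hc : c = 0 := by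
        rcases mul_eq_zero.1 (h3.symm.trans (by simp)) with h | h
        · exact h
        · exact absurd h hV
      subst hc
      rw [zero_smul, add_zero] at h2
      rw [hF.eq_zero h2 (fun l => congrFun h1 l)]
      rfl
    · rintro ⟨y, z⟩
      obtain ⟨x, hx⟩ := mem_range_flowMap G
        (z := z - ((∑ v, z v) / Fintype.card V) • (1 : V → ℝ)) (by
          simp only [Pi.sub_apply, Pi.smul_apply, Pi.one_apply, smul_eq_mul, mul_one,
            Finset.sum_sub_distrib, Finset.sum_const, Finset.card_univ, nsmul_eq_mul]
          field_simp
          ring)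
      have hlin : flowMap G (hF.linearPart (y - fun l : F => x l)) = 0 := by
        funext v
        show flowMap G (hF.solution _ - hF.solution 0) v = 0
        rw [map_sub, Pi.sub_apply, flowMap_apply, flowMap_apply, hF.flow_solution,
          hF.flow_solution, sub_self]
      refine ⟨(x + hF.linearPart (y - fun l : F => x l), (∑ v, z v) / Fintype.card V), ?_⟩
      rw [hΦ, map_add, hlin, add_zero, hx, sub_add_cancel]
      refine Prod.ext (funext fun l => ?_) rfl
      show x l + (hF.solution (y - fun l : F => x l) l - hF.solution 0 l) = y l
      rw [hF.solution_apply, hF.solution_apply]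
      simp
  have h := (LinearEquiv.ofBijective Φ hbij).finrank_eq
  simp only [Module.finrank_prod, Module.finrank_fintype_fun_eq_card, Module.finrank_self,
    Fintype.card_coe] at h
  exact h.symm

/-- Integrality of the constraints: integral data have integral solutions. -/
theorem IsIndependentSet.mem_range_intCast (hF : IsIndependentSet G N F) {x : E → ℝ}
    (h1 : ∀ v, flow G x v ∈ (Int.castRingHom ℝ).range)
    (h2 : ∀ l : F, x l ∈ (Int.castRingHom ℝ).range) (e : E) :
    x e ∈ (Int.castRingHom ℝ).range := by
  classical
  by_contra he
  -- B is the set of non-integral lines, disjoint from F, and W is the set of their ends. The flow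
  -- at a vertex of W is integral with coefficients ±1, so at least two lines of B meet there,
  -- whence |W| ≤ |B|. Independence makes the flow injective on functions supported on B, whence |B|
  -- ≤ |W|. The flow then maps onto ℝ^W, contradicting that flows sum to zero.
  let B : Finset E := Finset.univ.filter fun e => x e ∉ (Int.castRingHom ℝ).range
  let W : Finset V := Finset.univ.filter fun v => ∃ e ∈ B, G.src e = v ∨ G.tgt e = v
  have hB : ∀ e, e ∈ B ↔ x e ∉ (Int.castRingHom ℝ).range := by simp [B]
  have hW : ∀ v, v ∈ W ↔ ∃ e ∈ B, G.src e = v ∨ G.tgt e = v := by simp [W]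
  have heB : e ∈ B := (hB e).2 he
  have hdeg : ∀ v ∈ W, 2 ≤ (B.bipartiteAbove (fun v e => G.src e = v ∨ G.tgt e = v) v).card := by
    intro v hv
    obtain ⟨e₀, he₀, hinc⟩ := (hW v).1 hv
    by_contra hlt
    have hone : ∀ e ∈ B, (G.src e = v ∨ G.tgt e = v) → e = e₀ := by
      intro e he hinc'
      refine Finset.card_le_one.1 (Nat.le_of_lt_succ (not_le.1 hlt)) e ?_ e₀ ?_
      · exact Finset.mem_bipartiteAbove _ |>.2 ⟨he, hinc'⟩
      · exact Finset.mem_bipartiteAbove _ |>.2 ⟨he₀, hinc⟩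
    have hrest : ∑ e ∈ Finset.univ.erase e₀, (sign G v e : ℝ) * x e ∈
        (Int.castRingHom ℝ).range := by
      refine sum_mem fun e he => ?_
      by_cases heB : e ∈ B
      · have hn : ¬(G.src e = v ∨ G.tgt e = v) :=
          fun h => Finset.ne_of_mem_erase he (hone e heB h)
        rw [not_or] at hn
        have : sign G v e = 0 := by simp [sign, hn.1, hn.2]
        rw [this]
        simp
      · exact mul_mem ⟨sign G v e, rfl⟩ (not_not.1 fun h => heB ((hB e).2 h))
    have hflow := h1 v
    rw [flow, ← Finset.add_sum_erase _ _ (Finset.mem_univ e₀)] at hflow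
    have hmain := sub_mem hflow hrest
    rw [add_sub_cancel_right] at hmain
    apply (hB e₀).1 he₀
    by_cases ht : G.tgt e₀ = v
    · have : sign G v e₀ = 1 := by simp [sign, ht]
      simpa [this] using hmain
    · have hs : G.src e₀ = v := hinc.resolve_right ht
      have : sign G v e₀ = -1 := by simp [sign, ht, hs]
      rw [this] at hmain
      simpa using neg_mem hmain
  have hcard : W.card ≤ B.card := by
    have := Finset.card_mul_le_card_mul (fun v e => G.src e = v ∨ G.tgt e = v) (n := 2) hdeg
      (fun e _ => (Finset.card_le_card (t := {G.src e, G.tgt e}) fun v hv => by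
        have := (Finset.mem_bipartiteBelow _ |>.1 hv).2
        simp only [Finset.mem_insert, Finset.mem_singleton]
        exact this.imp Eq.symm Eq.symm).trans Finset.card_le_two)
    omega
  let ext : (B → ℝ) →ₗ[ℝ] (E → ℝ) := Function.ExtendByZero.linearMap ℝ (fun b : B => (b : E))
  have hext : ∀ (d : B → ℝ) (b : B), ext d b = d b := fun d b =>
    Subtype.val_injective.extend_apply d 0 b
  have hext0 : ∀ (d : B → ℝ) (e : E), e ∉ B → ext d e = 0 := fun d e he =>
    Function.extend_apply' d (0 : E → ℝ) e (by rintro ⟨b, rfl⟩; exact he b.2)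
  have hsupp : ∀ (d : B → ℝ) (v : V), v ∉ W → flowMap G (ext d) v = 0 := by
    intro d v hv
    refine Finset.sum_eq_zero fun e _ => ?_
    by_cases heB : e ∈ B
    · have hn : ¬(G.src e = v ∨ G.tgt e = v) := fun h => hv ((hW v).2 ⟨e, heB, h⟩)
      rw [not_or] at hn
      have : sign G v e = 0 := by simp [sign, hn.1, hn.2]
      rw [this]
      simp
    · rw [hext0 d e heB, mul_zero]
  let Φ : (B → ℝ) →ₗ[ℝ] (W → ℝ) :=
    (LinearMap.funLeft ℝ ℝ (fun v : W => (v : V))).comp ((flowMap G).comp ext)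
  have hΦ : ∀ d v, Φ d v = flowMap G (ext d) v := fun d v => rfl
  have hinj : Function.Injective Φ := by
    rw [← LinearMap.ker_eq_bot, LinearMap.ker_eq_bot']
    intro d hd
    have hz : ext d = 0 := by
      refine hF.eq_zero (funext fun v => ?_) fun l => hext0 d l fun hl => (hB l).1 hl (h2 l)
      by_cases hv : v ∈ W
      · exact congrFun hd ⟨v, hv⟩
      · exact hsupp d v hv
    funext b
    rw [← hext d b, hz]
    rfl
  have hle : B.card ≤ W.card := by
    simpa using LinearMap.finrank_le_finrank_of_injective hinj
  have hsurj : Function.Surjective Φ :=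
    (LinearMap.injective_iff_surjective_of_finrank_eq_finrank (by
      simpa using le_antisymm hle hcard)).1 hinj
  have hvW : G.src e ∈ W := (hW _).2 ⟨e, heB, Or.inl rfl⟩
  obtain ⟨d, hd⟩ := hsurj (Pi.single ⟨G.src e, hvW⟩ 1)
  have h0 : ∑ v : W, Φ d v = 0 := by
    rw [← sum_flow G (ext d)]
    simp_rw [hΦ]
    rw [Finset.sum_coe_sort W (fun v => flowMap G (ext d) v)]
    exact Finset.sum_subset (Finset.subset_univ W) fun v _ hv => hsupp d v hv
  rw [hd] at h0
  simp at h0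

end Independent

/-! ### Domination and continuity of the sum and the integral -/

section Bounds

variable {V E : Type*} [Fintype V] [DecidableEq V] [Fintype E] [DecidableEq E]

/-- From |u - y| ≤ 1 one has 1 + y² ≤ 2u² + 3. The unit of slack lets one bound dominate both the
integrand and its step approximations of mesh at most 1. -/
theorem one_div_sq_add_sq_le {a u y : ℝ} (ha : 0 < a) (huy : |u - y| ≤ 1) :
    1 / (u ^ 2 + a ^ 2) ≤ (2 + 3 / a ^ 2) * (1 + y ^ 2)⁻¹ := by
  rw [← div_eq_mul_inv, div_le_div_iff₀ (by positivity) (by positivity), one_mul]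
  have h1 : (u - y) ^ 2 ≤ 1 := by rw [← sq_abs]; nlinarith [abs_nonneg (u - y)]
  have h2 : (2 + 3 / a ^ 2) * (u ^ 2 + a ^ 2) = 2 * u ^ 2 + 2 * a ^ 2 + 3 / a ^ 2 * u ^ 2 + 3 := by
    field_simp
    ring
  rw [h2]
  have h3 : 0 ≤ 3 / a ^ 2 * u ^ 2 := by positivity
  nlinarith [sq_nonneg (2 * u - y)]

/-- An integrable bound for the integrand of the Matsubara integral. -/
def integrandBound (a : ℝ) (F : Finset E) (y : F → ℝ) : ℝ :=
  (∏ _e ∈ Finset.univ \ F, 1 / a ^ 2) * ∏ l : F, (2 + 3 / a ^ 2) * (1 + y l ^ 2)⁻¹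

theorem integrable_integrandBound (a : ℝ) (F : Finset E) : Integrable (integrandBound a F) := by
  refine Integrable.const_mul ?_ _
  exact Integrable.fintype_prod (μ := fun _ : F => (volume : Measure ℝ))
    (f := fun _ y => (2 + 3 / a ^ 2) * (1 + y ^ 2)⁻¹)
    fun _ => integrable_inv_one_add_sq.const_mul _

variable {G : MatsubaraGraph V E} {N : V → ℤ} {F : Finset E}

theorem propagators_solution_le (hF : IsIndependentSet G N F) {a : ℝ} (ha : 0 < a) {q : E → ℝ}
    (hq : ∀ e, a ≤ q e) {u y : F → ℝ} (huy : ∀ l, |u l - y l| ≤ 1) :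
    propagators q (hF.solution u) ≤ integrandBound a F y := by
  have hsq : ∀ e, a ^ 2 ≤ q e ^ 2 := fun e => pow_le_pow_left₀ ha.le (hq e) 2
  have ha2 : 0 < a ^ 2 := by positivity
  rw [propagators, ← Finset.prod_sdiff (Finset.subset_univ F), integrandBound]
  refine mul_le_mul (Finset.prod_le_prod (fun e _ => by positivity) fun e _ => ?_) ?_
    (Finset.prod_nonneg fun e _ => by positivity) (Finset.prod_nonneg fun e _ => by positivity)
  · exact one_div_le_one_div_of_le ha2 ((hsq e).trans (le_add_of_nonneg_left (sq_nonneg _)))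
  · rw [← Finset.prod_coe_sort F]
    refine Finset.prod_le_prod (fun e _ => by positivity) fun l _ => ?_
    rw [hF.solution_apply]
    exact (one_div_le_one_div_of_le (by positivity) (by gcongr; exact hq l)).trans
      (one_div_sq_add_sq_le ha (huy l))

theorem continuous_propagators_solution (hF : IsIndependentSet G N F) {q : E → ℝ}
    (hq : ∀ e, q e ≠ 0) : Continuous fun y : F → ℝ => propagators q (hF.solution y) := by
  refine continuous_finsetProd _ fun e _ => ?_
  refine continuous_const.div ?_ fun y => by have := hq e; positivity
  exact (((continuous_apply e).comp hF.continuous_solution).pow 2).add continuous_const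

theorem norm_propagators (q x : E → ℝ) : ‖propagators q x‖ = propagators q x :=
  Real.norm_of_nonneg (propagators_nonneg q x)

theorem exists_pos_forall_lt {q : E → ℝ} (hq : ∀ e, 0 < q e) : ∃ a > 0, ∀ e, a < q e := by
  obtain ⟨a, ha, h⟩ := Pi.exists_forall_pos_add_lt hq
  exact ⟨a, ha, fun e => by simpa using h e⟩

theorem integrable_propagators_solution (hF : IsIndependentSet G N F) {q : E → ℝ}
    (hq : ∀ e, 0 < q e) : Integrable fun y : F → ℝ => propagators q (hF.solution y) := by
  obtain ⟨a, ha, haq⟩ := exists_pos_forall_lt hq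
  refine (integrable_integrandBound a F).mono'
    (continuous_propagators_solution hF fun e => (hq e).ne').aestronglyMeasurable
    (Eventually.of_forall fun y => ?_)
  rw [norm_propagators]
  exact propagators_solution_le hF ha (fun e => (haq e).le) (fun l => by simp)

theorem continuousAt_propagators {q : E → ℝ} (hq : ∀ e, 0 < q e) (x : E → ℝ) :
    ContinuousAt (fun q => propagators q x) q := by
  refine tendsto_finsetProd _ fun e _ => ?_
  refine Tendsto.div tendsto_const_nhds (tendsto_const_nhds.add
    (((continuous_apply e).tendsto q).pow 2)) ?_
  have := hq e
  positivity

theorem eventually_forall_lt {q : E → ℝ} {a : ℝ} (h : ∀ e, a < q e) :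
    ∀ᶠ p in 𝓝 q, ∀ e, a < p e :=
  eventually_all.2 fun e => (continuous_apply e).continuousAt.eventually (lt_mem_nhds (h e))

theorem continuousAt_matsubaraIntegral (hF : IsIndependentSet G N F) {q : E → ℝ}
    (hq : ∀ e, 0 < q e) : ContinuousAt (matsubaraIntegral hF) q := by
  obtain ⟨a, ha, haq⟩ := exists_pos_forall_lt hq
  refine continuousAt_of_dominated (bound := integrandBound a F) ?_ ?_
    (integrable_integrandBound a F) ?_
  · filter_upwards [eventually_forall_lt haq] with p hp
    exact (continuous_propagators_solution hF
      fun e => (ha.trans (hp e)).ne').aestronglyMeasurable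
  · filter_upwards [eventually_forall_lt haq] with p hp
    refine Eventually.of_forall fun y => ?_
    rw [norm_propagators]
    exact propagators_solution_le hF ha (fun e => (hp e).le) (fun l => by simp)
  · exact Eventually.of_forall fun y => continuousAt_propagators hq _

theorem continuousAt_matsubaraSum (G : MatsubaraGraph V E) (N : V → ℤ) {q : E → ℝ}
    (hq : ∀ e, 0 < q e) : ContinuousAt (matsubaraSum G N) q := by
  obtain ⟨a, ha, haq⟩ := exists_pos_forall_lt hq
  refine tendsto_tsum_of_dominated_convergence
    (bound := fun n : E → ℤ => propagators (fun _ => a) fun e => (n e : ℝ))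
    (summable_propagators fun _ => ha.ne') (fun n => ?_) ?_
  · exact tendsto_const_nhds.mul (continuousAt_propagators hq _)
  · filter_upwards [eventually_forall_lt haq] with p hp n
    rw [Real.norm_of_nonneg (summand_nonneg G N p n)]
    refine (summand_le G N p n).trans (Finset.prod_le_prod (fun e _ => by positivity) fun e _ => ?_)
    have := (hp e).le
    gcongr

end Bounds

/-! ### The integral as a limit of rescaled sums -/

section RiemannSums

/-- Rewrites a lattice sum as the integral of a step function, to which dominated convergence
applies. -/
theorem map_floor_volume {ι : Type*} [Fintype ι] :
    (volume : Measure (ι → ℝ)).map (fun z i => ⌊z i⌋) = Measure.count := by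
  have h1 : (volume : Measure ℝ).map (fun x => ⌊x⌋) = Measure.count := by
    refine Measure.ext_of_singleton fun n => ?_
    rw [Measure.map_apply Int.measurable_floor (measurableSet_singleton n),
      Int.preimage_floor_singleton, Real.volume_Ico]
    simp
  have hσ : ∀ _ : ι, SigmaFinite ((volume : Measure ℝ).map (fun x => ⌊x⌋)) := by
    intro _
    rw [h1]
    infer_instance
  have h2 := Measure.pi_map_pi (μ := fun _ : ι => (volume : Measure ℝ))
    (f := fun (_ : ι) (x : ℝ) => ⌊x⌋) (hμ := hσ) fun _ => Int.measurable_floor.aemeasurable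
  rw [volume_pi, h2, h1, pi_count]

variable {V E : Type*} [Fintype V] [DecidableEq V] [Fintype E] [DecidableEq E]
variable {G : MatsubaraGraph V E} {N : V → ℤ} {F : Finset E}

theorem exists_int_solution (hF : IsIndependentSet G N F) {M : ℕ} (hM : M ≠ 0) (m : F → ℤ) :
    ∃ n : E → ℤ, ∀ e, (n e : ℝ) = M * hF.solution (fun l => m l / M) e := by
  have hM' : (M : ℝ) ≠ 0 := by exact_mod_cast hM
  suffices h : ∀ e, ∃ k : ℤ, (k : ℝ) = M * hF.solution (fun l => m l / M) e by
    choose n hn using h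
    exact ⟨n, hn⟩
  intro e
  have h := hF.mem_range_intCast (x := (M : ℝ) • hF.solution fun l => m l / M) ?_ ?_ e
  · obtain ⟨k, hk⟩ := h
    exact ⟨k, hk⟩
  · intro v
    refine ⟨M * N v, ?_⟩
    rw [← flowMap_apply, map_smul, Pi.smul_apply, flowMap_apply, hF.flow_solution]
    simp
  · intro l
    refine ⟨m l, ?_⟩
    rw [Pi.smul_apply, hF.solution_apply, smul_eq_mul, mul_div_cancel₀ _ hM']
    simp

theorem propagators_smul {M : ℝ} (q x : E → ℝ) :
    propagators (M • q) (M • x) = (M ^ (2 * Fintype.card E))⁻¹ * propagators q x := by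
  have h : ∀ e, 1 / ((M • x) e ^ 2 + (M • q) e ^ 2) =
      (M ^ 2)⁻¹ * (1 / (x e ^ 2 + q e ^ 2)) := by
    intro e
    rw [Pi.smul_apply, Pi.smul_apply, smul_eq_mul, smul_eq_mul,
      show (M * x e) ^ 2 + (M * q e) ^ 2 = M ^ 2 * (x e ^ 2 + q e ^ 2) by ring, one_div, mul_inv,
      one_div]
  simp_rw [propagators, h]
  rw [Finset.prod_mul_distrib, Finset.prod_const, Finset.card_univ, pow_mul, inv_pow]

/-- The points m/M of the F-coordinates correspond bijectively to the integer solutions with data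
MN: integrality of the constraints makes M times the solution an integer vector, and its
F-coordinates determine it. -/
theorem hasSum_scaled (hF : IsIndependentSet G N F) {q : E → ℝ} (hq : ∀ e, 0 < q e) {M : ℕ}
    (hM : M ≠ 0) : HasSum (fun m : F → ℤ => propagators q (hF.solution fun l => m l / M))
      ((M : ℝ) ^ (2 * Fintype.card E) *
        matsubaraSum G (fun v => M * N v) ((M : ℝ) • q)) := by
  have hM' : (M : ℝ) ≠ 0 := by exact_mod_cast hM
  choose i hi using exists_int_solution hF hM
  have hiF : ∀ m (l : F), i m l = m l := by
    intro m l
    have h := hi m l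
    rw [hF.solution_apply, mul_div_cancel₀ _ hM'] at h
    exact_mod_cast h
  have hinj : Function.Injective i := by
    intro m m' h
    funext l
    rw [← hiF m l, h, hiF m' l]
  have hterm : ∀ m, propagators q (hF.solution fun l => m l / M) =
      (M : ℝ) ^ (2 * Fintype.card E) *
        summand G (fun v => M * N v) ((M : ℝ) • q) (i m) := by
    intro m
    have hx : (fun e => (i m e : ℝ)) = (M : ℝ) • hF.solution fun l => m l / M :=
      funext fun e => hi m e
    have hflow : ∀ v, flow G (i m) v = M * N v := by
      intro v
      have h : flow G (fun e => (i m e : ℝ)) v = M * N v := by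
        rw [hx, ← flowMap_apply, map_smul, Pi.smul_apply, flowMap_apply, hF.flow_solution,
          smul_eq_mul]
      have h' : flow G (fun e => (i m e : ℝ)) v = ((flow G (i m) v : ℤ) : ℝ) := by simp [flow]
      rw [h'] at h
      exact_mod_cast h
    rw [summand, kroneckerDelta_eq, if_pos hflow, one_mul, hx, propagators_smul,
      mul_inv_cancel_left₀ (pow_ne_zero _ hM')]
  simp_rw [hterm]
  refine HasSum.mul_left _ ?_
  have hsupp : ∀ n ∉ Set.range i, summand G (fun v => M * N v) ((M : ℝ) • q) n = 0 := by
    intro n hn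
    rw [summand, kroneckerDelta_eq, if_neg, zero_mul]
    intro hflow
    refine hn ⟨fun l => n l, ?_⟩
    have hsol : (fun e => (n e : ℝ) / M) = hF.solution fun l : F => (n l : ℝ) / M := by
      refine hF.eq_solution (fun v => ?_) fun l => rfl
      have hfun : (fun e => (n e : ℝ) / M) = (M : ℝ)⁻¹ • fun e => (n e : ℝ) := by
        funext e
        rw [Pi.smul_apply, smul_eq_mul, div_eq_inv_mul]
      have h' : flow G (fun e => (n e : ℝ)) v = ((flow G n v : ℤ) : ℝ) := by simp [flow]
      rw [hfun, ← flowMap_apply, map_smul, Pi.smul_apply, flowMap_apply, h', hflow v, smul_eq_mul]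
      push_cast
      rw [inv_mul_cancel_left₀ hM']
    funext e
    have h := hi (fun l => n l) e
    rw [← hsol, mul_div_cancel₀ _ hM'] at h
    exact_mod_cast h
  refine (hinj.hasSum_iff hsupp).2 ?_
  exact (summable_summand G _ fun e => mul_ne_zero hM' (hq e).ne').hasSum

theorem integral_floor (hF : IsIndependentSet G N F) {q : E → ℝ} (hq : ∀ e, 0 < q e) {M : ℕ}
    (hM : M ≠ 0) :
    ∫ y : F → ℝ, propagators q (hF.solution fun l => (⌊M * y l⌋ : ℝ) / M) =
      (M : ℝ) ^ Fintype.card E * (M : ℝ) ^ (Fintype.card V - 1) *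
        matsubaraSum G (fun v => M * N v) ((M : ℝ) • q) := by
  have hM' : (M : ℝ) ≠ 0 := by exact_mod_cast hM
  have hs := hasSum_scaled hF hq hM
  have h1 : ∫ z : F → ℝ, propagators q (hF.solution fun l => (⌊z l⌋ : ℝ) / M) =
      (M : ℝ) ^ (2 * Fintype.card E) *
        matsubaraSum G (fun v => M * N v) ((M : ℝ) • q) := by
    rw [← hs.tsum_eq, ← integral_count_eq_tsum, ← map_floor_volume, integral_map]
    · exact (measurable_pi_lambda _ fun l =>
        Int.measurable_floor.comp (measurable_pi_apply l)).aemeasurable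
    · exact (Measurable.of_discrete).aestronglyMeasurable
    · simpa only [norm_propagators] using hs.summable
  have h2 := Measure.integral_comp_smul (volume : Measure (F → ℝ))
    (fun z => propagators q (hF.solution fun l => (⌊z l⌋ : ℝ) / M)) (M : ℝ)
  simp only [Pi.smul_apply, smul_eq_mul] at h2
  rw [h2, h1, Module.finrank_fintype_fun_eq_card, Fintype.card_coe,
    abs_of_nonneg (by positivity), ← mul_assoc]
  congr 1
  have hV : 0 < Fintype.card V := Fintype.card_pos_iff.2 G.connected.nonempty
  have hcard := hF.card_add_card
  -- The propagators scale with exponent 2|E| and the lattice cell with |F| = |E| - |V| + 1; the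
  -- difference is |E| + (|V| - 1).
  have he : 2 * Fintype.card E = F.card + (Fintype.card E + (Fintype.card V - 1)) := by omega
  rw [he, pow_add, inv_mul_cancel_left₀ (pow_ne_zero _ hM'), pow_add]

/-- The Matsubara integral as a limit of rescaled Matsubara sums. -/
theorem tendsto_scaled_matsubaraSum (hF : IsIndependentSet G N F) {q : E → ℝ}
    (hq : ∀ e, 0 < q e) :
    Tendsto (fun M : ℕ => (M : ℝ) ^ Fintype.card E * (M : ℝ) ^ (Fintype.card V - 1) *
        matsubaraSum G (fun v => M * N v) ((M : ℝ) • q)) atTop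
      (𝓝 (matsubaraIntegral hF q)) := by
  obtain ⟨a, ha, haq⟩ := exists_pos_forall_lt hq
  have hdist : ∀ M : ℕ, M ≠ 0 → ∀ y : ℝ, |(⌊M * y⌋ : ℝ) / M - y| ≤ 1 / M := by
    intro M hM y
    have hM' : (0 : ℝ) < M := by exact_mod_cast Nat.pos_of_ne_zero hM
    have h1 := Int.floor_le ((M : ℝ) * y)
    have h2 := (Int.lt_floor_add_one ((M : ℝ) * y)).le
    rw [show (⌊M * y⌋ : ℝ) / M - y = (⌊M * y⌋ - M * y) / M by field_simp, abs_div,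
      abs_of_pos hM']
    gcongr
    rw [abs_le]
    constructor <;> linarith
  have hmeas : ∀ M : ℕ, Measurable fun y : F → ℝ => fun l : F => (⌊M * y l⌋ : ℝ) / M := by
    intro M
    refine measurable_pi_lambda _ fun l => ?_
    have h : Measurable fun y : F → ℝ => ⌊(M : ℝ) * y l⌋ :=
      Int.measurable_floor.comp ((measurable_pi_apply l).const_mul _)
    exact (measurable_from_top.comp h).div_const _
  have hcont := continuous_propagators_solution hF (q := q) fun e => (hq e).ne'
  have hlim : Tendsto (fun M : ℕ => ∫ y : F → ℝ,
      propagators q (hF.solution fun l => (⌊M * y l⌋ : ℝ) / M)) atTop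
      (𝓝 (matsubaraIntegral hF q)) := by
    refine tendsto_integral_filter_of_dominated_convergence (integrandBound a F) ?_ ?_
      (integrable_integrandBound a F) ?_
    · exact Eventually.of_forall fun M => (hcont.measurable.comp (hmeas M)).aestronglyMeasurable
    · filter_upwards [eventually_ne_atTop 0] with M hM
      refine Eventually.of_forall fun y => ?_
      rw [norm_propagators]
      refine propagators_solution_le hF ha (fun e => (haq e).le) fun l => ?_
      refine (hdist M hM (y l)).trans ?_
      rw [div_le_one (by exact_mod_cast Nat.pos_of_ne_zero hM)]
      exact_mod_cast Nat.one_le_iff_ne_zero.2 hM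
    · refine Eventually.of_forall fun y => ?_
      refine (hcont.tendsto y).comp (tendsto_pi_nhds.2 fun l => ?_)
      rw [tendsto_iff_norm_sub_tendsto_zero]
      refine tendsto_of_tendsto_of_tendsto_of_le_of_le' tendsto_const_nhds
        tendsto_one_div_atTop_nhds_zero_nat (Eventually.of_forall fun M => norm_nonneg _) ?_
      filter_upwards [eventually_ne_atTop 0] with M hM using hdist M hM (y l)
  refine hlim.congr' ?_
  filter_upwards [eventually_ne_atTop 0] with M hM using integral_floor hF hq hM

end RiemannSums

/-! ### Homogeneity, and identification of the integral -/

section Scaling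

variable {V E : Type*} [Fintype V] [DecidableEq V] [Fintype E] [DecidableEq E]

theorem chainSum_mul (c : ℂ) (ω : Finset V → ℂ) (K S : Finset V) (hKS : K ⊆ S) :
    chainSum (fun T => c * ω T) K S = (c ^ (S \ K).card)⁻¹ * chainSum ω K S := by
  induction hn : S.card using Nat.strong_induction_on generalizing S with
  | _ n ih =>
    subst hn
    by_cases hS : S = K
    · subst hS; simp [chainSum_self]
    · rw [chainSum_of_ne _ hS, chainSum_of_ne _ hS, Finset.mul_sum, Finset.mul_sum, Finset.mul_sum]
      refine Finset.sum_congr rfl fun v hv => ?_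
      have hv' := Finset.mem_sdiff.1 hv
      rw [ih _ (Finset.card_erase_lt_of_mem hv'.1) _ (Finset.subset_erase.2 ⟨hKS, hv'.2⟩) rfl,
        Finset.erase_sdiff_comm, ← Finset.card_erase_add_one hv, ← mul_sub, mul_inv, pow_succ,
        mul_inv]
      ring

theorem cochainSum_mul (c : ℂ) (ω : Finset V → ℂ) (K S : Finset V) (hSK : S ⊆ K) :
    cochainSum (fun T => c * ω T) K S = (c ^ (K \ S).card)⁻¹ * cochainSum ω K S := by
  rw [cochainSum, chainSum_mul c (fun T => ω Tᶜ) _ _ (Finset.compl_subset_compl.2 hSK), cochainSum]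
  congr 4
  ext; simp [and_comm]

theorem flip_smul (A : Finset E) (c : ℝ) (q : E → ℝ) : flip A (c • q) = c • flip A q := by
  funext e
  by_cases h : e ∈ A <;> simp [flip, h]

theorem cutSum_smul (G : MatsubaraGraph V E) (c : ℝ) (q : E → ℝ) (K : Finset V) :
    cutSum G K (c • q) = c * cutSum G K q := by
  simp [cutSum, Finset.mul_sum]

theorem freq_smul (G : MatsubaraGraph V E) (N : V → ℤ) (M : ℕ) (q : E → ℝ) :
    freq G (fun v => M * N v) ((M : ℝ) • q) = fun K => (M : ℂ) * freq G N q K := by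
  funext K
  rw [freq, freq, cutSum_smul]
  push_cast
  rw [← Finset.mul_sum]
  ring

/-- There are |E| prefactors π/q_e, and every order of the vertices passes through |V| - 1
intermediate states, each contributing an inverse frequency. -/
theorem timeOrdered_smul (G : MatsubaraGraph V E) (N : V → ℤ) (v₀ : V) {M : ℕ} (hM : M ≠ 0)
    (q : E → ℝ) :
    (M : ℂ) ^ Fintype.card E * (M : ℂ) ^ (Fintype.card V - 1) *
      timeOrdered G (fun v => M * N v) v₀ ((M : ℝ) • q) = timeOrdered G N v₀ q := by
  have hM' : (M : ℂ) ≠ 0 := by exact_mod_cast hM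
  have h1 : (∏ e, (Real.pi / ((M : ℝ) • q) e : ℂ)) =
      ((M : ℂ) ^ Fintype.card E)⁻¹ * ∏ e, (Real.pi / q e : ℂ) := by
    rw [← inv_pow, ← Finset.card_univ, ← Finset.prod_const, ← Finset.prod_mul_distrib]
    refine Finset.prod_congr rfl fun e _ => ?_
    rw [Pi.smul_apply, smul_eq_mul]
    push_cast
    rw [div_mul_eq_div_div, div_right_comm, div_eq_inv_mul _ (M : ℂ)]
  have h2 : timeOrderedSum G (fun v => M * N v) v₀ ((M : ℝ) • q) =
      ((M : ℂ) ^ (Fintype.card V - 1))⁻¹ * timeOrderedSum G N v₀ q := by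
    rw [timeOrderedSum, timeOrderedSum, Finset.mul_sum, freq_smul]
    refine Finset.sum_congr rfl fun K hK => ?_
    have hv₀ : v₀ ∈ K := Finset.singleton_subset_iff.1 (Finset.mem_Icc.1 hK).1
    rw [chainSum_mul _ _ _ _ (Finset.empty_subset _),
      cochainSum_mul _ _ _ _ (Finset.subset_univ _), Finset.sdiff_empty]
    have hc1 : (Finset.univ \ (Kᶜ ∪ {v₀})).card = K.card - 1 := by
      rw [← Finset.card_erase_of_mem hv₀]
      congr 1
      ext v
      simp
    have hc2 : (Finset.univ \ K).card = Fintype.card V - K.card := by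
      rw [← Finset.compl_eq_univ_sdiff, Finset.card_compl]
    have hK1 : 0 < K.card := Finset.card_pos.2 ⟨v₀, hv₀⟩
    have hK2 : K.card ≤ Fintype.card V := Finset.card_le_univ K
    rw [hc1, hc2, show Fintype.card V - 1 = (K.card - 1) + (Fintype.card V - K.card) by omega,
      pow_add, mul_inv]
    ring
  rw [timeOrdered, h1, h2, timeOrdered]
  field_simp

theorem tendsto_bose_mul {q : ℝ} (hq : 0 < q) :
    Tendsto (fun M : ℕ => bose (M * q)) atTop (𝓝 0) := by
  have h1 : Tendsto (fun M : ℕ => Real.exp (2 * Real.pi * (M * q)) - 1) atTop atTop := by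
    refine tendsto_atTop_add_const_right _ _ (Real.tendsto_exp_atTop.comp ?_)
    exact (tendsto_natCast_atTop_atTop.atTop_mul_const hq).const_mul_atTop (by positivity)
  simp only [bose, one_div]
  exact h1.inv_tendsto_atTop

theorem tendsto_weight_smul {q : E → ℝ} (hq : ∀ e, 0 < q e) (A : Finset E) :
    Tendsto (fun M : ℕ => weight Finset.univ ((M : ℝ) • q) A) atTop
      (𝓝 (if A = ∅ then 1 else 0)) := by
  have h : ∀ e, Tendsto (fun M : ℕ => if e ∈ A then -bose (((M : ℝ) • q) e) else
      1 + bose (((M : ℝ) • q) e)) atTop (𝓝 (if e ∈ A then 0 else 1)) := by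
    intro e
    split_ifs
    · simpa using (tendsto_bose_mul (hq e)).neg
    · simpa using tendsto_const_nhds.add (tendsto_bose_mul (hq e))
  have h2 : (∏ e : E, if e ∈ A then (0 : ℝ) else 1) = if A = ∅ then 1 else 0 := by
    split_ifs with hA
    · subst hA; simp
    · obtain ⟨e, he⟩ := Finset.nonempty_iff_ne_empty.2 hA
      exact Finset.prod_eq_zero (Finset.mem_univ e) (if_pos he)
  rw [← h2]
  exact tendsto_finsetProd _ fun e _ => h e

/-- The points at which all energy denominators are different from zero, also after changes of
signs. -/
def genericPoints (G : MatsubaraGraph V E) : Set (E → ℝ) :=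
  {q | ∀ (A : Finset E) (K : Finset V), K ≠ ∅ → K ≠ Finset.univ → cutSum G K (flip A q) ≠ 0}

theorem smul_mem_genericPoints {G : MatsubaraGraph V E} {q : E → ℝ} (hq : q ∈ genericPoints G)
    {c : ℝ} (hc : c ≠ 0) : c • q ∈ genericPoints G := by
  intro A K h0 h1
  rw [flip_smul, cutSum_smul]
  exact mul_ne_zero hc (hq A K h0 h1)

/-- After a further reflection in the cut of T, the difference of the real parts is a multiple of
the cut sum of T' \ T. This set is nonempty and omits v₀, so genericity applies. -/
theorem freq_flip_ne {G : MatsubaraGraph V E} (N : V → ℤ) {q : E → ℝ} (hq : q ∈ genericPoints G)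
    (v₀ : V) (A : Finset E) (T T' : Finset V) (hv₀ : v₀ ∈ T) (hT : T ⊂ T') :
    freq G N (flip A q) T' ≠ freq G N (flip A q) T := by
  intro h
  have h1 := congrArg Complex.re h
  rw [freq_re, freq_re] at h1
  have h2 := mul_left_cancel₀ (by positivity : 2 * Real.pi ≠ 0) h1
  have h3 := cutSum_flip_sub_of_subset G (flip (symmDiff (cut G T) A) q) hT.1
  rw [flip_flip, symmDiff_symmDiff_cancel_left, h2, sub_self] at h3
  refine hq (symmDiff (cut G T) A) (T' \ T) ?_ ?_ h3.symm
  · rw [Ne, Finset.sdiff_eq_empty_iff_subset]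
    exact hT.2
  · intro h4
    have := Finset.mem_univ v₀
    rw [← h4] at this
    exact (Finset.mem_sdiff.1 this).2 hv₀

theorem matsubaraSum_eq_of_mem_genericPoints {G : MatsubaraGraph V E} {N : V → ℤ}
    (hN : ∑ v, N v = 0) {q : E → ℝ} (hq : ∀ e, q e ≠ 0) (hgen : q ∈ genericPoints G) (v₀ : V) :
    (matsubaraSum G N q : ℂ) =
      ∑ A : Finset E, (weight Finset.univ q A : ℂ) * timeOrdered G N v₀ (flip A q) :=
  matsubaraSum_eq_sum_timeOrdered G hN hq v₀ (freq_flip_ne N hgen v₀)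

/-- Away from the zeros of the denominators, the Matsubara integral is the sum over all time
orders. -/
theorem matsubaraIntegral_eq_timeOrdered {G : MatsubaraGraph V E} {N : V → ℤ}
    (hN : ∑ v, N v = 0) {F : Finset E} (hF : IsIndependentSet G N F) {q : E → ℝ}
    (hq : ∀ e, 0 < q e) (hgen : q ∈ genericPoints G) (v₀ : V) :
    (matsubaraIntegral hF q : ℂ) = timeOrdered G N v₀ q := by
  have h1 := (Complex.continuous_ofReal.tendsto _).comp (tendsto_scaled_matsubaraSum hF hq)
  -- By homogeneity the rescaled sums are combinations of fixed values of `timeOrdered` in which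
  -- only the weights depend on M; these tend to 1 for A = ∅ and to 0 otherwise. Uniqueness of the
  -- limit then gives the result.
  have h2 : Tendsto (fun M : ℕ => ∑ A : Finset E, (weight Finset.univ ((M : ℝ) • q) A : ℂ) *
      timeOrdered G N v₀ (flip A q)) atTop (𝓝 (∑ A : Finset E,
        (((if A = ∅ then 1 else 0 : ℝ)) : ℂ) * timeOrdered G N v₀ (flip A q))) :=
    tendsto_finsetSum _ fun A _ => ((Complex.continuous_ofReal.tendsto _).comp
      (tendsto_weight_smul hq A)).mul_const _
  rw [Finset.sum_eq_single ∅ (fun A _ hA => by simp [hA]) (by simp), flip_empty] at h2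
  simp only [if_true, Complex.ofReal_one, one_mul] at h2
  refine tendsto_nhds_unique (h1.congr' ?_) h2
  filter_upwards [eventually_ne_atTop 0] with M hM
  have hM' : (M : ℝ) ≠ 0 := by exact_mod_cast hM
  have hN' : ∑ v, (M : ℤ) * N v = 0 := by rw [← Finset.mul_sum, hN, mul_zero]
  simp only [Function.comp_apply, Complex.ofReal_mul, Complex.ofReal_pow, Complex.ofReal_natCast]
  rw [matsubaraSum_eq_of_mem_genericPoints (q := (M : ℝ) • q) hN' (fun e => mul_ne_zero hM' (hq e).ne')
    (smul_mem_genericPoints hgen hM') v₀, Finset.mul_sum]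
  refine Finset.sum_congr rfl fun A _ => ?_
  rw [← timeOrdered_smul G N v₀ hM, flip_smul]
  ring

end Scaling

/-! ### Rationality of the time-ordered sum -/

section Rational

variable {E : Type*} [Fintype E] [DecidableEq E]

/-- A complex function of `q` that is given by a quotient of polynomials, the denominator being
real and without zeros at positive `q`. -/
def IsComplexRational (f : (E → ℝ) → ℂ) : Prop :=
  ∃ P R Q : MvPolynomial E ℝ, (∀ q : E → ℝ, (∀ e, 0 < q e) → MvPolynomial.eval q Q ≠ 0) ∧
    ∀ q : E → ℝ, MvPolynomial.eval q Q ≠ 0 →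
      f q = (MvPolynomial.eval q P + Complex.I * MvPolynomial.eval q R) / MvPolynomial.eval q Q

theorem IsComplexRational.one : IsComplexRational fun _ : E → ℝ => 1 :=
  ⟨1, 0, 1, by simp, by simp⟩

theorem IsComplexRational.zero : IsComplexRational fun _ : E → ℝ => 0 :=
  ⟨0, 0, 1, by simp, by simp⟩

theorem IsComplexRational.add {f g : (E → ℝ) → ℂ} (hf : IsComplexRational f)
    (hg : IsComplexRational g) : IsComplexRational fun q => f q + g q := by
  obtain ⟨P, R, Q, h1, h2⟩ := hf
  obtain ⟨P', R', Q', h1', h2'⟩ := hg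
  refine ⟨P * Q' + P' * Q, R * Q' + R' * Q, Q * Q', fun q hq => ?_, fun q hq => ?_⟩
  · rw [map_mul]
    exact mul_ne_zero (h1 q hq) (h1' q hq)
  · rw [map_mul] at hq
    obtain ⟨a, b⟩ := mul_ne_zero_iff.1 hq
    have a' : ((MvPolynomial.eval q Q : ℝ) : ℂ) ≠ 0 := by exact_mod_cast a
    have b' : ((MvPolynomial.eval q Q' : ℝ) : ℂ) ≠ 0 := by exact_mod_cast b
    beta_reduce
    rw [h2 q a, h2' q b, div_add_div _ _ a' b']
    simp only [map_add, map_mul, Complex.ofReal_add, Complex.ofReal_mul]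
    congr 1
    ring

theorem IsComplexRational.mul {f g : (E → ℝ) → ℂ} (hf : IsComplexRational f)
    (hg : IsComplexRational g) : IsComplexRational fun q => f q * g q := by
  obtain ⟨P, R, Q, h1, h2⟩ := hf
  obtain ⟨P', R', Q', h1', h2'⟩ := hg
  refine ⟨P * P' - R * R', P * R' + R * P', Q * Q', fun q hq => ?_, fun q hq => ?_⟩
  · rw [map_mul]
    exact mul_ne_zero (h1 q hq) (h1' q hq)
  · rw [map_mul] at hq
    obtain ⟨a, b⟩ := mul_ne_zero_iff.1 hq
    beta_reduce
    rw [h2 q a, h2' q b, div_mul_div_comm]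
    simp only [map_add, map_sub, map_mul, Complex.ofReal_add, Complex.ofReal_sub,
      Complex.ofReal_mul]
    congr 1
    linear_combination (MvPolynomial.eval q R : ℂ) * (MvPolynomial.eval q R' : ℂ) * Complex.I_sq

theorem IsComplexRational.sum {α : Type*} (s : Finset α) {f : α → (E → ℝ) → ℂ}
    (hf : ∀ a ∈ s, IsComplexRational (f a)) : IsComplexRational fun q => ∑ a ∈ s, f a q := by
  classical
  induction s using Finset.induction_on with
  | empty => simpa using IsComplexRational.zero
  | insert a s ha ih =>
    simp_rw [Finset.sum_insert ha]
    exact (hf a (Finset.mem_insert_self _ _)).add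
      (ih fun b hb => hf b (Finset.mem_insert_of_mem hb))

theorem IsComplexRational.prod {α : Type*} (s : Finset α) {f : α → (E → ℝ) → ℂ}
    (hf : ∀ a ∈ s, IsComplexRational (f a)) : IsComplexRational fun q => ∏ a ∈ s, f a q := by
  classical
  induction s using Finset.induction_on with
  | empty => simpa using IsComplexRational.one
  | insert a s ha ih =>
    simp_rw [Finset.prod_insert ha]
    exact (hf a (Finset.mem_insert_self _ _)).mul
      (ih fun b hb => hf b (Finset.mem_insert_of_mem hb))

theorem isComplexRational_pi_div (e : E) : IsComplexRational fun q : E → ℝ => (Real.pi / q e : ℂ) :=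
  ⟨MvPolynomial.C Real.pi, 0, MvPolynomial.X e, fun q hq => by simpa using (hq e).ne',
    fun q _ => by simp⟩

variable {V : Type*} [Fintype V] [DecidableEq V]

theorem eval_cutPolynomial (G : MatsubaraGraph V E) (K : Finset V) (q : E → ℝ) :
    MvPolynomial.eval q (∑ e ∈ cut G K, MvPolynomial.X e) = cutSum G K q := by
  simp [cutSum]

theorem cutSum_pos (G : MatsubaraGraph V E) {K : Finset V} (h0 : K ≠ ∅) (h1 : K ≠ Finset.univ)
    {q : E → ℝ} (hq : ∀ e, 0 < q e) : 0 < cutSum G K q :=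
  Finset.sum_pos (fun e _ => hq e) (cut_nonempty G h0 h1)

/-- Multiplying by the conjugate makes the denominator 2π(a² + c²) with a the cut sum. The cut is
nonempty by connectedness, so a > 0 at positive q. -/
theorem isComplexRational_inv_freq (G : MatsubaraGraph V E) (N : V → ℤ) {K : Finset V}
    (h0 : K ≠ ∅) (h1 : K ≠ Finset.univ) : IsComplexRational fun q => (freq G N q K)⁻¹ := by
  let c : ℝ := ∑ v ∈ K, (N v : ℝ)
  let a : MvPolynomial E ℝ := ∑ e ∈ cut G K, MvPolynomial.X e
  have ha : ∀ q, MvPolynomial.eval q a = cutSum G K q := eval_cutPolynomial G K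
  refine ⟨a, MvPolynomial.C c, MvPolynomial.C (2 * Real.pi) * (a ^ 2 + MvPolynomial.C (c ^ 2)),
    fun q hq => ?_, fun q hq => ?_⟩
  · have := cutSum_pos G h0 h1 hq
    simp only [map_mul, map_add, map_pow, MvPolynomial.eval_C, ha]
    positivity
  · simp only [map_mul, map_add, map_pow, MvPolynomial.eval_C, ha] at hq ⊢
    have hc : (∑ v ∈ K, (N v : ℂ)) = c := by simp [c]
    have hq' : ((2 * Real.pi * (cutSum G K q ^ 2 + c ^ 2) : ℝ) : ℂ) ≠ 0 := by exact_mod_cast hq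
    have hprod : freq G N q K * (cutSum G K q + Complex.I * c) =
        ((2 * Real.pi * (cutSum G K q ^ 2 + c ^ 2) : ℝ) : ℂ) := by
      rw [freq, hc]
      push_cast
      linear_combination -(2 * Real.pi * (c : ℂ) ^ 2) * Complex.I_sq
    rw [eq_div_iff hq', ← hprod, inv_mul_cancel_left₀]
    exact fun h => hq' (by rw [← hprod, h, zero_mul])

theorem isComplexRational_chainSum (G : MatsubaraGraph V E) (N : V → ℤ) (S : Finset V)
    (hS : S ≠ Finset.univ) : IsComplexRational fun q => chainSum (freq G N q) ∅ S := by
  induction hn : S.card using Nat.strong_induction_on generalizing S with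
  | _ n ih =>
    subst hn
    by_cases h0 : S = ∅
    · subst h0
      simp_rw [chainSum_self]
      exact IsComplexRational.one
    · simp_rw [chainSum_of_ne _ h0, freq_empty, sub_zero]
      refine (isComplexRational_inv_freq G N h0 hS).mul (IsComplexRational.sum _ fun v hv => ?_)
      have hvS := (Finset.mem_sdiff.1 hv).1
      refine ih _ (Finset.card_erase_lt_of_mem hvS) _ (fun h => ?_) rfl
      have := Finset.mem_univ v
      rw [← h] at this
      simp at this

theorem isComplexRational_cochainSum (G : MatsubaraGraph V E) {N : V → ℤ} (hN : ∑ v, N v = 0)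
    (S : Finset V) (hS : S ≠ ∅) :
    IsComplexRational fun q => cochainSum (freq G N q) Finset.univ S := by
  induction hn : Sᶜ.card using Nat.strong_induction_on generalizing S with
  | _ n ih =>
    subst hn
    by_cases h1 : S = Finset.univ
    · subst h1
      simp_rw [cochainSum_self]
      exact IsComplexRational.one
    · simp_rw [cochainSum_of_ne _ h1, freq_univ G hN, sub_zero]
      refine (isComplexRational_inv_freq G N hS h1).mul (IsComplexRational.sum _ fun v hv => ?_)
      have hvS : v ∈ Sᶜ := Finset.mem_compl.2 (Finset.mem_sdiff.1 hv).2
      refine ih _ ?_ _ (Finset.insert_ne_empty _ _) rfl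
      rw [Finset.compl_insert]
      exact Finset.card_erase_lt_of_mem hvS

theorem isComplexRational_timeOrdered (G : MatsubaraGraph V E) {N : V → ℤ} (hN : ∑ v, N v = 0)
    (v₀ : V) : IsComplexRational (timeOrdered G N v₀) := by
  refine (IsComplexRational.prod _ fun e _ => isComplexRational_pi_div e).mul
    (IsComplexRational.sum _ fun K hK => ?_)
  have hv₀ : v₀ ∈ K := Finset.singleton_subset_iff.1 (Finset.mem_Icc.1 hK).1
  refine (isComplexRational_cochainSum G hN _ ?_).mul (isComplexRational_chainSum G N _ ?_)
  · exact Finset.ne_empty_of_mem (Finset.mem_union_right _ (Finset.mem_singleton_self v₀))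
  · intro h
    have := Finset.mem_univ v₀
    rw [← h] at this
    exact (Finset.mem_sdiff.1 this).2 hv₀

/-- Passing to real parts loses nothing: the weights, the sum and the integral are real. -/
theorem IsComplexRational.exists_re {f : (E → ℝ) → ℂ} (hf : IsComplexRational f) :
    ∃ P Q : MvPolynomial E ℝ, (∀ q : E → ℝ, (∀ e, 0 < q e) → MvPolynomial.eval q Q ≠ 0) ∧
      ∀ q : E → ℝ, MvPolynomial.eval q Q ≠ 0 → (f q).re = ratFun P Q q := by
  obtain ⟨P, R, Q, h1, h2⟩ := hf
  refine ⟨P, Q, h1, fun q hq => ?_⟩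
  rw [h2 q hq, Complex.div_ofReal_re, ratFun]
  simp

end Rational

/-! ### Density, uniqueness of the rational form, continuity -/

section Density

variable {E : Type*} [Fintype E] [DecidableEq E]

/-- On the line from q to a point where P does not vanish, P restricts to a nonzero polynomial in
one variable, which has finitely many roots. -/
theorem dense_eval_ne_zero {P : MvPolynomial E ℝ} (hP : P ≠ 0) :
    Dense {q : E → ℝ | MvPolynomial.eval q P ≠ 0} := by
  intro q
  obtain ⟨r, hr⟩ : ∃ r : E → ℝ, MvPolynomial.eval r P ≠ 0 := by
    by_contra! h
    exact hP (MvPolynomial.funext fun r => by rw [h r, map_zero])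
  let p : Polynomial ℝ := MvPolynomial.aeval
    (fun e => Polynomial.C (q e) + Polynomial.X * Polynomial.C (r e - q e)) P
  have hp : ∀ t, p.eval t = MvPolynomial.eval (fun e => q e + t * (r e - q e)) P := by
    intro t
    rw [← Polynomial.coe_evalRingHom, ← MvPolynomial.eval₂_id, show p = MvPolynomial.eval₂ _ _ P
      from MvPolynomial.aeval_def _ _, MvPolynomial.hom_eval₂]
    congr 1
    · ext; simp
    · funext e; simp
  have hp0 : p ≠ 0 := by
    intro h
    have := hp 1
    rw [h] at this
    simp only [Polynomial.eval_zero, one_mul, add_sub_cancel] at this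
    exact hr this.symm
  have hev : ∀ᶠ t in 𝓝[≠] (0 : ℝ), p.eval t ≠ 0 := by
    have hfin : {t | p.eval t = 0}.Finite :=
      (p.roots.toFinset.finite_toSet).subset fun t ht => by
        simpa [hp0] using ht
    have h := (hfin.subset (Set.sdiff_subset (t := {(0 : ℝ)}))).isClosed.isOpen_compl.mem_nhds
      (show (0 : ℝ) ∈ ({t | p.eval t = 0} \ {0})ᶜ by simp)
    filter_upwards [nhdsWithin_le_nhds h, self_mem_nhdsWithin] with t ht ht0 h0
    exact ht ⟨h0, ht0⟩
  have hlim : Tendsto (fun t : ℝ => fun e => q e + t * (r e - q e)) (𝓝[≠] 0) (𝓝 q) := by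
    have hc : Continuous fun t : ℝ => fun e => q e + t * (r e - q e) := by fun_prop
    have := hc.tendsto 0
    simp only [zero_mul, add_zero] at this
    exact this.mono_left nhdsWithin_le_nhds
  refine mem_closure_of_tendsto hlim ?_
  filter_upwards [hev] with t ht
  rwa [hp] at ht

/-- The product of all polynomials obtained from `Q` by changes of signs of the variables. -/
def flipProduct (Q : MvPolynomial E ℝ) : MvPolynomial E ℝ :=
  ∏ A : Finset E, MvPolynomial.aeval
    (fun e => if e ∈ A then -MvPolynomial.X e else MvPolynomial.X e : E → MvPolynomial E ℝ) Q

theorem eval_aeval_flip (A : Finset E) (Q : MvPolynomial E ℝ) (q : E → ℝ) :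
    MvPolynomial.eval q (MvPolynomial.aeval
      (fun e => if e ∈ A then -MvPolynomial.X e else MvPolynomial.X e : E → MvPolynomial E ℝ) Q) =
      MvPolynomial.eval (flip A q) Q := by
  rw [← MvPolynomial.eval₂_id, ← MvPolynomial.eval₂_id, MvPolynomial.aeval_def,
    MvPolynomial.eval₂_id, MvPolynomial.hom_eval₂]
  congr 1
  · ext; simp
  · funext e
    by_cases h : e ∈ A <;> simp [flip, h]

theorem mem_regularPoints {Q : MvPolynomial E ℝ} {q : E → ℝ} :
    q ∈ regularPoints Q ↔ ∀ A : Finset E, MvPolynomial.eval (flip A q) Q ≠ 0 := Iff.rfl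

theorem regularPoints_eq (Q : MvPolynomial E ℝ) :
    regularPoints Q = {q | MvPolynomial.eval q (flipProduct Q) ≠ 0} := by
  ext q
  simp only [mem_regularPoints, flipProduct, map_prod, eval_aeval_flip, Set.mem_ofPred_eq,
    Finset.prod_ne_zero_iff, Finset.mem_univ, true_imp_iff]

theorem dense_regularPoints {Q : MvPolynomial E ℝ} (hQ : Q ≠ 0) : Dense (regularPoints Q) := by
  rw [regularPoints_eq]
  refine dense_eval_ne_zero (Finset.prod_ne_zero_iff.2 fun A _ h => hQ ?_)
  refine MvPolynomial.funext fun q => ?_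
  have := eval_aeval_flip A Q (flip A q)
  rw [h, flip_flip, symmDiff_self, Finset.bot_eq_empty, flip_empty] at this
  exact this.symm

theorem regularPoints_mul {P Q : MvPolynomial E ℝ} {q : E → ℝ} (h : q ∈ regularPoints (P * Q)) :
    q ∈ regularPoints P ∧ q ∈ regularPoints Q := by
  simp only [mem_regularPoints, map_mul, mul_ne_zero_iff] at h
  exact ⟨fun A => (h A).1, fun A => (h A).2⟩

theorem isOpen_positive : IsOpen {q : E → ℝ | ∀ e, 0 < q e} := by
  have : {q : E → ℝ | ∀ e, 0 < q e} = Set.pi Set.univ fun _ => Set.Ioi 0 := by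
    ext; simp
  rw [this]
  exact isOpen_set_pi Set.finite_univ fun _ _ => isOpen_Ioi

/-- Two representations of a function on the positive orthant agree everywhere. -/
theorem IsRationalForm.ratFun_eq {I : (E → ℝ) → ℝ} {P Q P' Q' : MvPolynomial E ℝ}
    (h : IsRationalForm I P Q) (h' : IsRationalForm I P' Q') {q : E → ℝ}
    (hq : MvPolynomial.eval q Q ≠ 0) (hq' : MvPolynomial.eval q Q' ≠ 0) :
    ratFun P Q q = ratFun P' Q' q := by
  -- Otherwise some positive point would have this polynomial and both denominators nonzero, against
  -- the common value of the two forms there. Being a polynomial identity, it also covers the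
  -- reflected points.
  have hR : P * Q' - P' * Q = 0 := by
    by_contra hR
    obtain ⟨p, hp, hpos⟩ := (dense_eval_ne_zero (mul_ne_zero hR (mul_ne_zero h.1 h'.1))).exists_mem_open
      isOpen_positive ⟨fun _ => 1, fun _ => one_pos⟩
    simp only [Set.mem_ofPred_eq, map_mul, mul_ne_zero_iff] at hp
    obtain ⟨h1, h2, h3⟩ := hp
    have heq := (h.2 p hpos h2).symm.trans (h'.2 p hpos h3)
    rw [ratFun, ratFun, div_eq_div_iff h2 h3] at heq
    apply h1
    simp [heq]
  have := congrArg (MvPolynomial.eval q) hR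
  rw [ratFun, ratFun, div_eq_div_iff hq hq']
  simpa [sub_eq_zero] using this

theorem continuousAt_ratFun (P : MvPolynomial E ℝ) {Q : MvPolynomial E ℝ} {q : E → ℝ}
    (hq : MvPolynomial.eval q Q ≠ 0) : ContinuousAt (ratFun P Q) q :=
  (MvPolynomial.continuous_eval P).continuousAt.div (MvPolynomial.continuous_eval Q).continuousAt hq

theorem continuousAt_matsubaraOperator (P : MvPolynomial E ℝ) {Q : MvPolynomial E ℝ} {q : E → ℝ}
    (hpos : ∀ e, 0 < q e) (hq : q ∈ regularPoints Q) :
    ContinuousAt (matsubaraOperator E (ratFun P Q)) q := by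
  rw [show matsubaraOperator E (ratFun P Q) = fun q => ∑ A : Finset E,
    weight Finset.univ q A * ratFun P Q (flip A q) from funext (matsubaraOperator_apply _)]
  refine tendsto_finsetSum _ fun A _ => (continuousAt_weight hpos A).mul ?_
  exact ContinuousAt.comp (f := flip A) (continuousAt_ratFun P (hq A))
    (continuous_flip A).continuousAt

theorem eq_of_dense_of_continuousAt {D : Set (E → ℝ)} (hD : Dense D) {f g : (E → ℝ) → ℝ}
    {q : E → ℝ} (hf : ContinuousAt f q) (hg : ContinuousAt g q) (hq : ∀ e, 0 < q e)
    (h : ∀ p ∈ D, (∀ e, 0 < p e) → f p = g p) : f q = g q := by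
  refine tendsto_nhds_unique_of_frequently_eq hf hg ?_
  refine ((mem_closure_iff_frequently.1 (hD q)).and_eventually
    (isOpen_positive.mem_nhds hq)).mono fun p hp => h p hp.1 hp.2

end Density

/-! ### Assembly of the rational representation -/

section Main

variable {V E : Type*} [Fintype V] [DecidableEq V] [Fintype E] [DecidableEq E]

theorem exists_cutPolynomial (G : MatsubaraGraph V E) :
    ∃ C : MvPolynomial E ℝ, C ≠ 0 ∧ regularPoints C ⊆ genericPoints G := by
  refine ⟨∏ K ∈ Finset.univ.filter fun K : Finset V => K ≠ ∅ ∧ K ≠ Finset.univ,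
    ∑ e ∈ cut G K, MvPolynomial.X e, ?_, fun q hq A K h0 h1 => ?_⟩
  · refine Finset.prod_ne_zero_iff.2 fun K hK h => ?_
    obtain ⟨h0, h1⟩ := (Finset.mem_filter.1 hK).2
    have := eval_cutPolynomial G K fun _ => 1
    rw [h, map_zero] at this
    exact (cutSum_pos G h0 h1 (q := fun _ => 1) fun _ => one_pos).ne this
  · have := mem_regularPoints.1 hq A
    rw [map_prod, Finset.prod_ne_zero_iff] at this
    rw [← eval_cutPolynomial]
    exact this K (Finset.mem_filter.2 ⟨Finset.mem_univ K, h0, h1⟩)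

/-- A rational function that represents the Matsubara integral and, together with the operator,
the Matsubara sum. -/
theorem exists_rationalForm (G : MatsubaraGraph V E) {N : V → ℤ} (hN : ∑ v, N v = 0) :
    ∃ P Q : MvPolynomial E ℝ, (∀ q : E → ℝ, (∀ e, 0 < q e) → MvPolynomial.eval q Q ≠ 0) ∧
      (∀ (F : Finset E) (hF : IsIndependentSet G N F),
        IsRationalForm (matsubaraIntegral hF) P Q) ∧
      ∀ q : E → ℝ, (∀ e, 0 < q e) → q ∈ genericPoints G → q ∈ regularPoints Q →
        matsubaraSum G N q = matsubaraOperator E (ratFun P Q) q := by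
  obtain ⟨v₀⟩ := G.connected.nonempty
  obtain ⟨P, Q, hQ, hPQ⟩ := (isComplexRational_timeOrdered G hN v₀).exists_re
  obtain ⟨C, hC, hCgen⟩ := exists_cutPolynomial G
  refine ⟨P, Q, hQ, fun F hF => ⟨?_, fun q hq hq' => ?_⟩, fun q hq hgen hreg => ?_⟩
  · rintro rfl
    exact hQ (fun _ => 1) (fun _ => one_pos) (map_zero _)
  -- Equality with the time-ordered sum is known only at generic points; continuity of the integral
  -- and of the rational function extends it to all positive q.
  · refine eq_of_dense_of_continuousAt (dense_regularPoints hC)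
      (continuousAt_matsubaraIntegral hF hq) (continuousAt_ratFun P hq') hq fun p hp hpos => ?_
    rw [← hPQ p (hQ p hpos), ← matsubaraIntegral_eq_timeOrdered hN hF hpos (hCgen hp) v₀,
      Complex.ofReal_re]
  · have h := congrArg Complex.re
      (matsubaraSum_eq_of_mem_genericPoints hN (fun e => (hq e).ne') hgen v₀)
    rw [Complex.ofReal_re, Complex.re_sum] at h
    rw [h, matsubaraOperator_apply]
    refine Finset.sum_congr rfl fun A _ => ?_
    rw [Complex.re_ofReal_mul, hPQ _ (mem_regularPoints.1 hreg A)]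

end Main

end

end Matsubara

/-! ### The theorem for an arbitrary rational form -/

theorem theorem1 {V E : Type*} [Fintype V] [DecidableEq V] [Fintype E] [DecidableEq E]
    (G : MatsubaraGraph V E) (N : V → ℤ) (hN : ∑ v, N v = 0) :
    -- the sum and the integral are well defined and converge
    (∃ F : Finset E, Matsubara.IsIndependentSet G N F) ∧
    (∀ q : E → ℝ, (∀ e, 0 < q e) → Summable (Matsubara.summand G N q)) ∧
    (∀ (F : Finset E) (hF : Matsubara.IsIndependentSet G N F) (q : E → ℝ), (∀ e, 0 < q e) →
      Integrable fun y : F → ℝ => Matsubara.propagators q (hF.solution y)) ∧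
    -- for positive `q` the integral is a rational function of `q`, without poles there,
    -- which does not depend on the choice of the independent variables
    (∃ P Q : MvPolynomial E ℝ, (∀ q : E → ℝ, (∀ e, 0 < q e) → MvPolynomial.eval q Q ≠ 0) ∧
      ∀ (F : Finset E) (hF : Matsubara.IsIndependentSet G N F),
        Matsubara.IsRationalForm (Matsubara.matsubaraIntegral hF) P Q) ∧
    -- the operator applied to this rational function gives the sum
    ∀ (F : Finset E) (hF : Matsubara.IsIndependentSet G N F) (P Q : MvPolynomial E ℝ),
      Matsubara.IsRationalForm (Matsubara.matsubaraIntegral hF) P Q →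
      ∀ q : E → ℝ, (∀ e, 0 < q e) →
        (q ∈ Matsubara.regularPoints Q →
          Matsubara.matsubaraSum G N q =
            Matsubara.matsubaraOperator E (Matsubara.ratFun P Q) q) ∧
        (𝓝[Matsubara.regularPoints Q] q).NeBot ∧
        Tendsto (Matsubara.matsubaraOperator E (Matsubara.ratFun P Q))
          (𝓝[Matsubara.regularPoints Q] q) (𝓝 (Matsubara.matsubaraSum G N q)) := by
  obtain ⟨P₀, Q₀, hQ₀, hform, hsum⟩ := Matsubara.exists_rationalForm G hN
  obtain ⟨C, hC, hCgen⟩ := Matsubara.exists_cutPolynomial G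
  refine ⟨Matsubara.exists_isIndependentSet G hN,
    fun q hq => Matsubara.summable_summand G N fun e => (hq e).ne',
    fun F hF q hq => Matsubara.integrable_propagators_solution hF hq, ⟨P₀, Q₀, hQ₀, hform⟩,
    fun F hF P Q hPQ => ?_⟩
  have key : ∀ q : E → ℝ, (∀ e, 0 < q e) → q ∈ Matsubara.regularPoints Q →
      Matsubara.matsubaraSum G N q = Matsubara.matsubaraOperator E (Matsubara.ratFun P Q) q := by
    intro q hq hreg
    -- The given form may have other spurious zeros than P₀/Q₀. The comparison is made on the dense
    -- set where the cut sums, Q and Q₀ are nonzero after all sign changes, and carried to q by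
    -- continuity.
    refine Matsubara.eq_of_dense_of_continuousAt
      (Matsubara.dense_regularPoints (mul_ne_zero hC (mul_ne_zero hPQ.1 (hform F hF).1)))
      (Matsubara.continuousAt_matsubaraSum G N hq)
      (Matsubara.continuousAt_matsubaraOperator P hq hreg) hq fun p hp hpos => ?_
    obtain ⟨h1, h2⟩ := Matsubara.regularPoints_mul hp
    obtain ⟨h2, h3⟩ := Matsubara.regularPoints_mul h2
    rw [hsum p hpos (hCgen h1) h3, Matsubara.matsubaraOperator_apply,
      Matsubara.matsubaraOperator_apply]
    exact Finset.sum_congr rfl fun A _ => by rw [(hform F hF).ratFun_eq hPQ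
      (Matsubara.mem_regularPoints.1 h3 A) (Matsubara.mem_regularPoints.1 h2 A)]
  intro q hq
  refine ⟨key q hq, mem_closure_iff_nhdsWithin_neBot.1 (Matsubara.dense_regularPoints hPQ.1 q), ?_⟩
  refine ((Matsubara.continuousAt_matsubaraSum G N hq).tendsto.mono_left
    nhdsWithin_le_nhds).congr' ?_
  filter_upwards [self_mem_nhdsWithin,
    nhdsWithin_le_nhds (Matsubara.isOpen_positive.mem_nhds hq)] with p hp hpos
  exact key p hpos hp
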